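/- Let $(\Theta,\mathcal T,\nu)$ be a $\sigma$-finite measure space (for example a measurable subset of $\mathbb R^d$ with Lebesgue measure $\mathrm d\theta$), let $\pi$ be a probability density on $\Theta$ with respect to $\nu$ (the probability measure with this density is also denoted $\pi$), let $q(\theta,\theta')$ be a jointly measurable Markov transition density with respect to $\nu$, and write $q(\theta,\mathrm d\theta')=q(\theta,\theta')\,\nu(\mathrm d\theta')$. Let $\kappa>0$, and let $\varphi(\mathrm dw;-\kappa^2/2,\kappa^2)$ be the normal distribution with mean $-\kappa^2/2$ and variance $\kappa^2$. Put $$r_{\mathrm{EX}}(\theta,\theta')=\frac{\pi(\theta')q(\theta',\theta)}{\pi(\theta)q(\theta,\theta')}\quad(\text{set to }1\text{ where the denominator vanishes}),$$ $$\alpha_{\mathrm{EX}}(\theta,\theta')=\min\{1,r_{\mathrm{EX}}(\theta,\theta')\},\qquad \alpha_{\hat Q}(\theta,\theta')=\int\varphi(\mathrm dw;-\kappa^2/2,\kappa^2)\min\{1,r_{\mathrm{EX}}(\theta,\theta')e^{w}\},$$ and define the kernels $$Q_{\mathrm{EX}}(\theta,\mathrm d\theta')=q(\theta,\mathrm d\theta')\alpha_{\mathrm{EX}}(\theta,\theta')+\{1-\varrho_{\mathrm{EX}}(\theta)\}\delta_\theta(\mathrm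 d\theta'),\qquad \varrho_{\mathrm{EX}}(\theta)=\int q(\theta,\mathrm d\theta')\alpha_{\mathrm{EX}}(\theta,\theta'),$$ $$\hat Q(\theta,\mathrm d\theta')=q(\theta,\mathrm d\theta')\alpha_{\hat Q}(\theta,\theta')+\{1-\varrho_{\hat Q}(\theta)\}\delta_\theta(\mathrm d\theta'),\qquad \varrho_{\hat Q}(\theta)=\int q(\theta,\mathrm d\theta')\alpha_{\hat Q}(\theta,\theta'),$$ $$Q^*(\theta,\mathrm d\theta')=\varrho_U(\kappa)\,Q_{\mathrm{EX}}(\theta,\mathrm d\theta')+\{1-\varrho_U(\kappa)\}\,\delta_\theta(\mathrm d\theta'),\qquad \varrho_U(\kappa)=\int\varphi(\mathrm dw;-\kappa^2/2,\kappa^2)\min\{1,e^{w}\}.$$ For $h\in L^2(\pi)$ with $\bar h=h-\pi(h)$ and $\pi(\bar h^2)>0$, and a $\pi$-invariant Markov kernel $K$, let $\phi_n(h,K)=\pi(\bar h\,K^nh)/\pi(\bar h^2)$ and $\mathrm{IF}(h,K)=1+2\sum_{n\ge1}\phi_n(h,K)$, the limit of the partial sums in $[-\infty,\infty]$ when it exists.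 A $\pi$-invariant Markov kernel $K$ is called geometrically ergodic if there are $\rho\in[0,1)$ and $M:\Theta\to\mathbb R$ such that, for $\pi$-almost every $\theta$, $\sup_{A}|K^n(\theta,A)-\pi(A)|\le M(\theta)\rho^n$ for all $n\ge0$. Then: 1. $\varrho_U(\kappa)=2\Phi(-\kappa/2)$, where $\Phi$ is the standard normal distribution function, and $Q^*$ is reversible with respect to $\pi$. 2. For every $h\in L^2(\pi)$ with $\pi(\bar h^2)>0$, the inefficiencies $\mathrm{IF}(h,\hat Q)$ and $\mathrm{IF}(h,Q^*)$ exist (as limits in $[-\infty,\infty]$), and $$\mathrm{IF}(h,\hat Q)\le\mathrm{IF}(h,Q^*),$$ with equality when $\varrho_{\mathrm{EX}}(\theta)=1$ for $\pi$-almost every $\theta$. Whenever $\mathrm{IF}(h,Q_{\mathrm{EX}})$ exists (possibly with the value $+\infty$), $$\mathrm{IF}(h,Q^*)=\frac{1+\mathrm{IF}(h,Q_{\mathrm{EX}})}{\varrho_U(\kappa)}-1;$$ it does exist for all such $h$ unless $-1$ is an eigenvalue of $Q_{\mathrm{EX}}$ on $L^2(\pi)$. 3. The kernel $Q^*$ can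 be written $q(\theta,\mathrm d\theta')\alpha_{Q^*}(\theta,\theta')+\{1-\varrho_{Q^*}(\theta)\}\delta_\theta(\mathrm d\theta')$ with $\alpha_{Q^*}=\varrho_U(\kappa)\,\alpha_{\mathrm{EX}}$ and $\varrho_{Q^*}(\theta)=\int q(\theta,\mathrm d\theta')\alpha_{Q^*}(\theta,\theta')$, and the average acceptance probabilities $\bar\varrho_{Q^*}(\kappa)=\pi(\varrho_{Q^*})$ and $\bar\varrho_{\hat Q}(\kappa)=\pi(\varrho_{\hat Q})$ satisfy $$\bar\varrho_{Q^*}(\kappa)=\varrho_U(\kappa)\,\pi(\varrho_{\mathrm{EX}})\le\bar\varrho_{\hat Q}(\kappa).$$ 4. If $Q_{\mathrm{EX}}$ is geometrically ergodic, then $Q^*$ is geometrically ergodic. -/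

import Mathlib

open MeasureTheory ProbabilityTheory Filter Topology
open scoped NNReal ENNReal

noncomputable section

namespace BoundingChain

/-! ### Markov chain notions: autocorrelation, inefficiency, geometric ergodicity -/

section General

variable {E : Type*} [MeasurableSpace E]

/-- The function `Kⁿ h`, where `Kⁿ` is the `n`-fold composition of the kernel `K`. -/
def iterApply (K : Kernel E E) (n : ℕ) (h : E → ℝ) (x : E) : ℝ :=
  ∫ y, h y ∂((K ^ n) x)

/-- The centred function `h - μ(h)`. -/
def centred (μ : Measure E) (h : E → ℝ) (x : E) : ℝ :=
  h x - ∫ y, h y ∂μ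

/-- The autocorrelation at lag `n` of `h` for the chain with kernel `K`, started from `μ`. -/
def autocorr (μ : Measure E) (K : Kernel E E) (h : E → ℝ) (n : ℕ) : ℝ :=
  (∫ x, centred μ h x * iterApply K n h x ∂μ) / ∫ x, centred μ h x ^ 2 ∂μ

/-- `HasIF μ K h v` says that the inefficiency `1 + 2 ∑_{n ≥ 1} φ_n(h, K)` has the value `v`:
its partial sums converge to the extended real number `v` (so `v = ⊤` is allowed). -/
def HasIF (μ : Measure E) (K : Kernel E E) (h : E → ℝ) (v : EReal) : Prop :=
  Tendsto (fun N : ℕ => ((1 + 2 * ∑ n ∈ Finset.Icc 1 N, autocorr μ K h n : ℝ) : EReal))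
    atTop (𝓝 v)

/-- Geometric convergence of `Kⁿ(x, ·)` to `μ` in total variation, from `μ`-almost every `x`,
with a rate `ρ < 1` that does not depend on `x` and a finite constant `M x`. -/
def GeometricallyErgodic (K : Kernel E E) (μ : Measure E) : Prop :=
  ∃ ρ : ℝ, 0 ≤ ρ ∧ ρ < 1 ∧ ∃ M : E → ℝ, ∀ᵐ x ∂μ, ∀ n : ℕ, ∀ A : Set E, MeasurableSet A →
    |((K ^ n) x).real A - μ.real A| ≤ M x * ρ ^ n

/-- The lazy version of `K`: with probability `a` move according to `K`, otherwise stay put. -/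
def lazyKernel (a : ℝ) (K : Kernel E E) : Kernel E E where
  toFun x := ENNReal.ofReal a • K x + ENNReal.ofReal (1 - a) • Measure.dirac x
  measurable' := by
    refine Measure.measurable_of_measurable_coe _ fun s hs => ?_
    have h1 : Measurable fun x => K x s := K.measurable_coe hs
    have h2 : Measurable fun x : E => Measure.dirac x s :=
      (Measure.measurable_coe hs).comp Measure.measurable_dirac
    simp only [Measure.add_apply, Measure.smul_apply, smul_eq_mul]
    exact (h1.const_mul _).add (h2.const_mul _)

end General

/-! ### Kernels of Metropolis–Hastings type -/

section MH

variable {Θ : Type*} [MeasurableSpace Θ]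

/-- The probability measure with density `p` with respect to the reference measure `ν`. -/
def target (ν : Measure Θ) (p : Θ → ℝ≥0) : Measure Θ :=
  ν.withDensity fun θ => (p θ : ℝ≥0∞)

/-- The probability that a proposal made at `θ` is accepted: `∫ q(θ, θ') α(θ, θ') ν(dθ')`. -/
def accProb (ν : Measure Θ) (q : Θ → Θ → ℝ≥0) (α : Θ → Θ → ℝ≥0∞) (θ : Θ) : ℝ≥0∞ :=
  ∫⁻ θ', (q θ θ' : ℝ≥0∞) * α θ θ' ∂ν

/-- The average acceptance probability at stationarity. -/
def avgAccProb (ν : Measure Θ) (p : Θ → ℝ≥0) (q : Θ → Θ → ℝ≥0) (α : Θ → Θ → ℝ≥0∞) : ℝ≥0∞ :=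
  ∫⁻ θ, accProb ν q α θ ∂(target ν p)

/-- The kernel that proposes from the density `q(θ, ·)` and accepts with probability
`α(θ, θ')`: `q(θ, dθ') α(θ, θ') + {1 - ϱ(θ)} δ_θ(dθ')`. See `mhKernel_apply`. -/
def mhKernel (ν : Measure Θ) [SFinite ν] (q : Θ → Θ → ℝ≥0) (α : Θ → Θ → ℝ≥0∞) : Kernel Θ Θ :=
  Kernel.withDensity (Kernel.const Θ ν) (fun θ θ' => (q θ θ' : ℝ≥0∞) * α θ θ') +
    Kernel.withDensity Kernel.id (fun θ _ => 1 - accProb ν q α θ)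

theorem mhKernel_apply (ν : Measure Θ) [SFinite ν] {q : Θ → Θ → ℝ≥0} {α : Θ → Θ → ℝ≥0∞}
    (hq : Measurable (Function.uncurry q)) (hα : Measurable (Function.uncurry α)) (θ : Θ) :
    mhKernel ν q α θ = ν.withDensity (fun θ' => (q θ θ' : ℝ≥0∞) * α θ θ') +
      (1 - accProb ν q α θ) • Measure.dirac θ := by
  have h1 : Measurable (Function.uncurry fun θ θ' => (q θ θ' : ℝ≥0∞) * α θ θ') :=
    (measurable_coe_nnreal_ennreal.comp hq).mul hα
  have h2 : Measurable (accProb ν q α) := h1.lintegral_prod_right'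
  have h3 : Measurable (Function.uncurry fun θ (_ : Θ) => 1 - accProb ν q α θ) :=
    (measurable_const.sub h2).comp measurable_fst
  rw [mhKernel, _root_.add_apply, Kernel.withDensity_apply _ h1, Kernel.withDensity_apply _ h3]
  simp [Kernel.id_apply, withDensity_const]

/-- The acceptance ratio `r_EX(θ, θ') = π(θ') q(θ', θ) / {π(θ) q(θ, θ')}`, set to `1` where the
denominator vanishes (such pairs have probability zero at stationarity). -/
def rEX (p : Θ → ℝ≥0) (q : Θ → Θ → ℝ≥0) (θ θ' : Θ) : ℝ≥0 :=
  if p θ * q θ θ' = 0 then 1 else p θ' * q θ' θ / (p θ * q θ θ')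

/-- The exact acceptance probability `min{1, r_EX(θ, θ')}`. -/
def alphaEX (p : Θ → ℝ≥0) (q : Θ → Θ → ℝ≥0) (θ θ' : Θ) : ℝ≥0∞ :=
  ((min 1 (rEX p q θ θ') : ℝ≥0) : ℝ≥0∞)

/-- The normal distribution with mean `-κ²/2` and variance `κ²`. -/
def noise (κ : ℝ) : Measure ℝ :=
  gaussianReal (-(κ ^ 2) / 2) (κ ^ 2).toNNReal

/-- The acceptance probability `∫ φ(dw; -κ²/2, κ²) min{1, r_EX(θ, θ') exp(w)}`. -/
def alphaHat (κ : ℝ) (p : Θ → ℝ≥0) (q : Θ → Θ → ℝ≥0) (θ θ' : Θ) : ℝ≥0∞ :=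
  ∫⁻ w, ENNReal.ofReal (min 1 ((rEX p q θ θ' : ℝ) * Real.exp w)) ∂(noise κ)

/-- `ϱ_U(κ) = ∫ φ(dw; -κ²/2, κ²) min{1, exp(w)}`. -/
def rhoU (κ : ℝ) : ℝ :=
  ∫ w, min 1 (Real.exp w) ∂(noise κ)

/-- The exact Metropolis–Hastings kernel. -/
def QEX (ν : Measure Θ) [SFinite ν] (p : Θ → ℝ≥0) (q : Θ → Θ → ℝ≥0) : Kernel Θ Θ :=
  mhKernel ν q (alphaEX p q)

/-- The kernel `Q̂`, whose log acceptance ratio is perturbed by Gaussian noise. -/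
def QHat (ν : Measure Θ) [SFinite ν] (κ : ℝ) (p : Θ → ℝ≥0) (q : Θ → Θ → ℝ≥0) : Kernel Θ Θ :=
  mhKernel ν q (alphaHat κ p q)

/-- The bounding kernel `Q* = ϱ_U(κ) Q_EX + {1 - ϱ_U(κ)} δ`. -/
def QStar (ν : Measure Θ) [SFinite ν] (κ : ℝ) (p : Θ → ℝ≥0) (q : Θ → Θ → ℝ≥0) : Kernel Θ Θ :=
  lazyKernel (rhoU κ) (QEX ν p q)

/-- The acceptance probability of a proposal under `Q*`: `ϱ_U(κ) α_EX(θ, θ')`. -/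
def alphaStar (κ : ℝ) (p : Θ → ℝ≥0) (q : Θ → Θ → ℝ≥0) (θ θ' : Θ) : ℝ≥0∞ :=
  ENNReal.ofReal (rhoU κ) * alphaEX p q θ θ'

end MH

end BoundingChain

end

/-! A reversible Markov kernel acts on $L^2(\pi)$ as a self-adjoint contraction $P$, so for a unit
vector $h$ the inefficiency is the limit of $2\sum_{n\le N}\langle h,P^nh\rangle-1$. Even
coefficients are $\|P^mh\|^2$, and each dominates the modulus of the next odd one. Partial sums of
even length are therefore monotone. If $-1$ is not an eigenvalue, the coefficients converge to some
$c\ge0$, so all partial sums converge or tend to $+\infty$ (`exists_tendsto_sum_opCorr`). Both $\hat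
Q$ and $Q^*$ reject with positive probability from every state, because the Gaussian noise charges
every half-line; this rules out the eigenvalue $-1$.

No spectral theorem is needed: Abel summation (`tendsto_opGen_of_opIF`) expresses an existing
inefficiency through $\langle h,(1-sP)^{-1}h\rangle$ as $s\uparrow1$. This quantity is monotone in
the quadratic form of $P$ (`opGen_le_opGen`) and transforms explicitly when $P$ is replaced by
$aP+1-a$ (`opGen_lazy`).

The comparison is Peskun's: $\min\{1,e^w\}\min\{1,r\}\le\min\{1,re^w\}$ gives
$\alpha_{Q^*}\le\alpha_{\hat Q}$, which orders the Dirichlet forms. The Gaussian enters through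
$e^w\varphi(w)=\varphi(-w)$, which yields detailed balance for $\hat Q$ and the closed form of
$\varrho_U$. Geometric ergodicity passes to $Q^*$ because its $n$-step law is a binomial mixture of
the iterates of $Q_{\mathrm{EX}}$. -/

namespace BoundingChain

/-! ### Self-adjoint contractions: correlation sums, resolvents and Abel limits -/

section Hilbert

open scoped InnerProductSpace

variable {H : Type*} [NormedAddCommGroup H] [InnerProductSpace ℝ H]

/-- The coefficients `⟪h, Pⁿ h⟫`. -/
noncomputable def opCorr (P : H →L[ℝ] H) (h : H) (n : ℕ) : ℝ := ⟪h, (P ^ n) h⟫_ℝ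

theorem opCorr_add {P : H →L[ℝ] H} (hP : P.IsSymmetric) (h : H) (m n : ℕ) :
    opCorr P h (m + n) = ⟪(P ^ m) h, (P ^ n) h⟫_ℝ := by
  induction m generalizing n with
  | zero => simp [opCorr]
  | succ m ih =>
    have h1 : m + 1 + n = m + (n + 1) := by omega
    rw [h1, ih, pow_succ' P n, pow_succ' P m]
    exact (hP _ _).symm

theorem norm_apply_le_self {P : H →L[ℝ] H} (hc : ‖P‖ ≤ 1) (f : H) : ‖P f‖ ≤ ‖f‖ := by
  simpa using P.le_of_opNorm_le hc f

theorem norm_pow_apply_le_self {P : H →L[ℝ] H} (hc : ‖P‖ ≤ 1) (f : H) (n : ℕ) :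
    ‖(P ^ n) f‖ ≤ ‖f‖ := by
  induction n with
  | zero => simp
  | succ n ih =>
    rw [pow_succ']
    exact (norm_apply_le_self hc _).trans ih

theorem inner_add_mul_inner_nonneg {P : H →L[ℝ] H} (hc : ‖P‖ ≤ 1) {s : ℝ} (hs : |s| ≤ 1)
    (f : H) : 0 ≤ ⟪f, f⟫_ℝ + s * ⟪f, P f⟫_ℝ := by
  have h1 : |⟪f, P f⟫_ℝ| ≤ ‖f‖ * ‖f‖ :=
    (abs_real_inner_le_norm _ _).trans (by gcongr; exact norm_apply_le_self hc f)
  have h2 : |s * ⟪f, P f⟫_ℝ| ≤ ‖f‖ * ‖f‖ := by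
    rw [abs_mul]
    calc |s| * |⟪f, P f⟫_ℝ| ≤ 1 * (‖f‖ * ‖f‖) := by gcongr
      _ = _ := one_mul _
  rw [real_inner_self_eq_norm_mul_norm]
  linarith [neg_abs_le (s * ⟪f, P f⟫_ℝ)]

/-- By symmetry the pair is the quadratic form of $1+sP$ at $P^mh$, which is nonnegative for a
contraction. -/
theorem opCorr_pair_nonneg {P : H →L[ℝ] H} (hP : P.IsSymmetric) (hc : ‖P‖ ≤ 1) {s : ℝ}
    (hs : |s| ≤ 1) (h : H) (m : ℕ) :
    0 ≤ opCorr P h (2 * m) + s * opCorr P h (2 * m + 1) := by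
  have h1 : 2 * m = m + m := by omega
  rw [h1, opCorr_add hP, add_assoc, opCorr_add hP, pow_succ' P m]
  exact inner_add_mul_inner_nonneg hc hs _

/-- Used with $s=1$ for the correlation sums themselves and with $0<s<1$ for their power series. -/
theorem monotone_even_sum {P : H →L[ℝ] H} (hP : P.IsSymmetric) (hc : ‖P‖ ≤ 1) {s : ℝ}
    (hs : |s| ≤ 1) (h : H) :
    Monotone fun M : ℕ => ∑ n ∈ Finset.range (2 * M), s ^ n * opCorr P h n := by
  refine monotone_nat_of_le_succ fun M => ?_
  have h1 : 2 * (M + 1) = 2 * M + 1 + 1 := by omega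
  rw [h1, Finset.sum_range_succ, Finset.sum_range_succ]
  have h2 := opCorr_pair_nonneg hP hc hs h M
  have h3 : 0 ≤ s ^ (2 * M) := by rw [pow_mul]; positivity
  have h4 := mul_nonneg h3 h2
  rw [pow_succ]
  nlinarith

/-- The generating function `∑ sⁿ ⟪h, Pⁿ h⟫`. -/
noncomputable def opGen (P : H →L[ℝ] H) (h : H) (s : ℝ) : ℝ := ∑' n, s ^ n * opCorr P h n

theorem abs_opCorr_le {P : H →L[ℝ] H} (hc : ‖P‖ ≤ 1) (h : H) (n : ℕ) :
    |opCorr P h n| ≤ ‖h‖ * ‖h‖ :=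
  (abs_real_inner_le_norm _ _).trans (by gcongr; exact norm_pow_apply_le_self hc h n)

theorem summable_opGen {P : H →L[ℝ] H} (hc : ‖P‖ ≤ 1) (h : H) {s : ℝ} (hs0 : 0 ≤ s)
    (hs1 : s < 1) : Summable fun n => s ^ n * opCorr P h n := by
  refine Summable.of_norm_bounded
    ((summable_geometric_of_lt_one hs0 hs1).mul_right (‖h‖ * ‖h‖)) fun n => ?_
  rw [norm_mul, norm_pow, Real.norm_of_nonneg hs0, Real.norm_eq_abs]
  gcongr
  exact abs_opCorr_le hc h n

/-- The vector $u=(1-sP)^{-1}h$ is the Neumann series, which converges because $s\|P\|<1$. -/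
theorem exists_resolvent [CompleteSpace H] {P : H →L[ℝ] H} (hc : ‖P‖ ≤ 1) (h : H) {s : ℝ}
    (hs0 : 0 ≤ s) (hs1 : s < 1) : ∃ u : H, u - s • P u = h ∧ opGen P h s = ⟪h, u⟫_ℝ := by
  have hsum : Summable fun n => s ^ n • (P ^ n) h := by
    refine Summable.of_norm_bounded
      ((summable_geometric_of_lt_one hs0 hs1).mul_right ‖h‖) fun n => ?_
    rw [norm_smul, norm_pow, Real.norm_of_nonneg hs0]
    gcongr
    exact norm_pow_apply_le_self hc h n
  refine ⟨∑' n, s ^ n • (P ^ n) h, ?_, ?_⟩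
  · have h1 : s • P (∑' n, s ^ n • (P ^ n) h) = ∑' n, s ^ (n + 1) • (P ^ (n + 1)) h := by
      rw [P.map_tsum hsum, ← tsum_const_smul'']
      congr 1 with n
      rw [map_smul, smul_smul, pow_succ', pow_succ' P]
      rfl
    rw [h1, hsum.tsum_eq_zero_add]
    simp
  · have := ((innerSL ℝ h).hasSum hsum.hasSum).tsum_eq
    rw [innerSL_apply_apply] at this
    rw [← this, opGen]
    congr 1 with n
    simp [opCorr]

theorem resolvent_unique {P : H →L[ℝ] H} (hc : ‖P‖ ≤ 1) {s : ℝ}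
    (hs0 : 0 ≤ s) (hs1 : s < 1) {u v : H} (huv : u - s • P u = v - s • P v) : u = v := by
  have h1 : u - v = s • P (u - v) := by
    rw [map_sub, smul_sub]
    have h2 : u - v - (s • P u - s • P v) = 0 := by
      rw [← sub_eq_zero.mpr huv]
      abel
    exact sub_eq_zero.mp h2
  have h2 : ‖u - v‖ ≤ s * ‖u - v‖ := by
    conv_lhs => rw [h1, norm_smul, Real.norm_of_nonneg hs0]
    gcongr
    exact norm_apply_le_self hc _
  have h3 : ‖u - v‖ = 0 := by nlinarith [norm_nonneg (u - v)]
  exact sub_eq_zero.mp (norm_eq_zero.mp h3)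

/-- Let $u,v$ solve $(1-sP)u=h=(1-sP')v$. Expanding the nonnegative form of $1-sP'$ at $u-v$ gives
$0\le\langle u,(1-sP')u\rangle-2\langle h,u\rangle+\langle h,v\rangle$, and the first term is at
most $\langle u,(1-sP)u\rangle=\langle h,u\rangle$. -/
theorem opGen_le_opGen [CompleteSpace H] {P P' : H →L[ℝ] H} (hP' : P'.IsSymmetric)
    (hc : ‖P‖ ≤ 1) (hc' : ‖P'‖ ≤ 1) (hle : ∀ f, ⟪f, P f⟫_ℝ ≤ ⟪f, P' f⟫_ℝ) (h : H) {s : ℝ}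
    (hs0 : 0 ≤ s) (hs1 : s < 1) : opGen P h s ≤ opGen P' h s := by
  obtain ⟨u, hu, hu'⟩ := exists_resolvent hc h hs0 hs1
  obtain ⟨v, hv, hv'⟩ := exists_resolvent hc' h hs0 hs1
  rw [hu', hv']
  have h1 : 0 ≤ ⟪u - v, u - v⟫_ℝ + (-s) * ⟪u - v, P' (u - v)⟫_ℝ :=
    inner_add_mul_inner_nonneg hc' (by rw [abs_neg, abs_of_nonneg hs0]; exact hs1.le) _
  have h2 : ⟪h, u⟫_ℝ = ⟪u, u⟫_ℝ - s * ⟪u, P u⟫_ℝ := by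
    rw [real_inner_comm]; nth_rewrite 1 [← hu]; simp [inner_sub_right, inner_smul_right]
  have h3 : ⟪h, v⟫_ℝ = ⟪v, v⟫_ℝ - s * ⟪v, P' v⟫_ℝ := by
    rw [real_inner_comm]; nth_rewrite 1 [← hv]; simp [inner_sub_right, inner_smul_right]
  have h4 : ⟪h, u⟫_ℝ = ⟪u, v⟫_ℝ - s * ⟪u, P' v⟫_ℝ := by
    rw [real_inner_comm]; nth_rewrite 1 [← hv]; simp [inner_sub_right, inner_smul_right]
  have h5 : ⟪v, P' u⟫_ℝ = ⟪u, P' v⟫_ℝ := by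
    rw [real_inner_comm]; exact hP' u v
  have h6 : ⟪v, u⟫_ℝ = ⟪u, v⟫_ℝ := real_inner_comm _ _
  simp only [map_sub, inner_sub_left, inner_sub_right, h5, h6] at h1
  have h7 := mul_le_mul_of_nonneg_left (hle u) hs0
  linarith

/-- With $d=1-s+sa$ one has $1-sP'=d\,(1-(sa/d)P)$, so the resolvents are proportional. -/
theorem opGen_lazy [CompleteSpace H] {P P' : H →L[ℝ] H} (hc : ‖P‖ ≤ 1) (hc' : ‖P'‖ ≤ 1)
    {a : ℝ} (ha0 : 0 < a) (hP' : ∀ f, P' f = a • P f + (1 - a) • f) (h : H) {s : ℝ}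
    (hs0 : 0 ≤ s) (hs1 : s < 1) :
    opGen P' h s = opGen P h (s * a / (1 - s + s * a)) / (1 - s + s * a) := by
  set d := 1 - s + s * a with hd
  have hd0 : 0 < d := by nlinarith [mul_nonneg hs0 ha0.le]
  have hs'0 : 0 ≤ s * a / d := by positivity
  have hs'1 : s * a / d < 1 := by rw [div_lt_one hd0]; linarith
  obtain ⟨u, hu, hu'⟩ := exists_resolvent hc h hs'0 hs'1
  obtain ⟨v, hv, hv'⟩ := exists_resolvent hc' h hs0 hs1
  have h1 : v = d⁻¹ • u := by
    refine resolvent_unique hc' hs0 hs1 ?_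
    rw [hv, hP', ← hu, map_smul]
    match_scalars
    · field_simp
      rw [hd]; ring
    · field_simp
  rw [hu', hv', h1, inner_smul_right]
  field_simp

theorem opCorr_even {P : H →L[ℝ] H} (hP : P.IsSymmetric) (h : H) (m : ℕ) :
    opCorr P h (2 * m) = ‖(P ^ m) h‖ ^ 2 := by
  rw [two_mul, opCorr_add hP, real_inner_self_eq_norm_sq]

/-- If `-1` is not an eigenvalue, the coefficients converge to a nonnegative limit. -/
theorem exists_tendsto_opCorr [CompleteSpace H] {P : H →L[ℝ] H} (hP : P.IsSymmetric)
    (hc : ‖P‖ ≤ 1) (hne : ∀ v, P v = -v → v = 0) (h : H) :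
    ∃ c, 0 ≤ c ∧ Tendsto (opCorr P h) atTop (𝓝 c) := by
  have hanti : Antitone fun m => opCorr P h (2 * m) := by
    refine antitone_nat_of_succ_le fun m => ?_
    rw [opCorr_even hP, opCorr_even hP, pow_succ' P]
    exact pow_le_pow_left₀ (norm_nonneg _) (norm_apply_le_self hc _) 2
  have hbdd : BddBelow (Set.range fun m => opCorr P h (2 * m)) := by
    refine ⟨0, ?_⟩
    rintro _ ⟨m, rfl⟩
    simp only [opCorr_even hP]
    positivity
  obtain ⟨c, hcl⟩ : ∃ c, Tendsto (fun m => opCorr P h (2 * m)) atTop (𝓝 c) :=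
    ⟨_, tendsto_atTop_ciInf hanti hbdd⟩
  have hc0 : 0 ≤ c := ge_of_tendsto' hcl fun m => by rw [opCorr_even hP]; positivity
  -- The squared distance between even iterates is a second difference of the convergent even
  -- coefficients; four errors of at most $\varepsilon^2/4$ make up $\varepsilon^2$.
  have hcauchy : CauchySeq fun m : ℕ => (P ^ (2 * m)) h := by
    rw [Metric.cauchySeq_iff]
    intro ε hε
    obtain ⟨N, hN⟩ := Metric.tendsto_atTop.mp hcl (ε ^ 2 / 4) (by positivity)
    refine ⟨N, fun m hm n hn => ?_⟩
    have h1 := abs_lt.mp (hN (2 * m) (by omega))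
    have h2 := abs_lt.mp (hN (2 * n) (by omega))
    have h3 := abs_lt.mp (hN (m + n) (by omega))
    have h4 : dist ((P ^ (2 * m)) h) ((P ^ (2 * n)) h) ^ 2 = opCorr P h (2 * (2 * m))
        - 2 * opCorr P h (2 * (m + n)) + opCorr P h (2 * (2 * n)) := by
      rw [dist_eq_norm, norm_sub_sq_real, mul_add 2 m n, opCorr_add hP, opCorr_even hP,
        opCorr_even hP]
    refine lt_of_pow_lt_pow_left₀ 2 hε.le ?_
    rw [h4]
    linarith [h1.1, h1.2, h2.1, h2.2, h3.1, h3.2]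
  obtain ⟨w, hw⟩ := cauchySeq_tendsto_of_complete hcauchy
  have hPPw : P (P w) = w := by
    have h1 : Tendsto (fun m : ℕ => P (P ((P ^ (2 * m)) h))) atTop (𝓝 (P (P w))) :=
      ((P.continuous.comp P.continuous).tendsto w).comp hw
    have h2 := hw.comp (tendsto_add_atTop_nat 1)
    refine tendsto_nhds_unique h1 (h2.congr fun m => ?_)
    simp only [Function.comp_apply]
    rw [show 2 * (m + 1) = 2 * m + 1 + 1 by omega, pow_succ', pow_succ']
    rfl
  -- Since $P^2w=w$, the vector $w-Pw$ satisfies $Pv=-v$; this is where the eigenvalue hypothesis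
  -- enters. It makes the odd coefficients share the limit of the even ones.
  have hPw : P w = w := by
    have h1 := hne (w - P w) (by rw [map_sub, hPPw]; abel)
    exact (sub_eq_zero.mp h1).symm
  have heven : Tendsto (fun m => opCorr P h (2 * m)) atTop (𝓝 ⟪h, w⟫_ℝ) :=
    tendsto_const_nhds.inner hw
  have hodd : Tendsto (fun m => opCorr P h (2 * m + 1)) atTop (𝓝 ⟪h, w⟫_ℝ) := by
    have h1 : Tendsto (fun m : ℕ => P ((P ^ (2 * m)) h)) atTop (𝓝 (P w)) :=
      (P.continuous.tendsto w).comp hw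
    rw [hPw] at h1
    refine (tendsto_const_nhds.inner h1).congr fun m => ?_
    rw [opCorr, pow_succ']
    rfl
  have hcw := tendsto_nhds_unique hcl heven
  refine ⟨c, hc0, ?_⟩
  rw [hcw]
  rw [tendsto_atTop'] at heven hodd ⊢
  intro s hs
  obtain ⟨M, hM⟩ := heven s hs
  obtain ⟨N, hN⟩ := hodd s hs
  refine ⟨2 * max M N + 1, fun n hn => ?_⟩
  rcases Nat.even_or_odd' n with ⟨k, rfl | rfl⟩
  · exact hM k (by omega)
  · exact hN k (by omega)

theorem exists_tendsto_sum_opCorr [CompleteSpace H] {P : H →L[ℝ] H} (hP : P.IsSymmetric)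
    (hc : ‖P‖ ≤ 1) (hne : ∀ v, P v = -v → v = 0) (h : H) :
    (∃ l, Tendsto (fun N => ∑ n ∈ Finset.range N, opCorr P h n) atTop (𝓝 l)) ∨
      Tendsto (fun N => ∑ n ∈ Finset.range N, opCorr P h n) atTop atTop := by
  obtain ⟨c, hc0, hcl⟩ := exists_tendsto_opCorr hP hc hne h
  have hmono : Monotone fun M : ℕ => ∑ n ∈ Finset.range (2 * M), opCorr P h n := by
    simpa using monotone_even_sum hP hc (s := 1) (by simp) h
  have hodd : Tendsto (fun m : ℕ => opCorr P h (2 * m)) atTop (𝓝 c) :=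
    hcl.comp (tendsto_id.const_mul_atTop' (by norm_num))
  rcases tendsto_atTop_of_monotone hmono with htop | ⟨l, hl⟩
  · right
    rw [tendsto_atTop_atTop] at htop ⊢
    intro b
    obtain ⟨M, hM⟩ := htop (b + 1)
    obtain ⟨N, hN⟩ := eventually_atTop.mp (hodd.eventually (lt_mem_nhds (show c - 1 < c by linarith)))
    refine ⟨2 * max M N + 1, fun n hn => ?_⟩
    rcases Nat.even_or_odd' n with ⟨k, rfl | rfl⟩
    · linarith [hM k (by omega)]
    · rw [Finset.sum_range_succ]
      linarith [hM k (by omega), hN k (by omega)]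
  · left
    -- Increments of the convergent even sums tend to $0$, and also to $2c$.
    have hc' : c = 0 := by
      have h1 := hl.comp (tendsto_add_atTop_nat 1)
      have h2 := h1.sub hl
      have h3 : Tendsto (fun m : ℕ => opCorr P h (2 * m + 1)) atTop (𝓝 c) :=
        hcl.comp ((tendsto_add_atTop_nat 1).comp (tendsto_id.const_mul_atTop' (by norm_num)))
      have h4 := tendsto_nhds_unique h2 ((hodd.add h3).congr fun m => by
        simp only [Function.comp_apply]
        rw [show 2 * (m + 1) = 2 * m + 1 + 1 by omega, Finset.sum_range_succ,
          Finset.sum_range_succ]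
        ring)
      linarith
    subst hc'
    refine ⟨l, ?_⟩
    have hl' : Tendsto (fun M : ℕ => ∑ n ∈ Finset.range (2 * M + 1), opCorr P h n) atTop
        (𝓝 l) := by
      simpa [Finset.sum_range_succ] using hl.add hodd
    rw [tendsto_atTop'] at hl hl' ⊢
    intro s hs
    obtain ⟨M, hM⟩ := hl s hs
    obtain ⟨N, hN⟩ := hl' s hs
    refine ⟨2 * max M N + 1, fun n hn => ?_⟩
    rcases Nat.even_or_odd' n with ⟨k, rfl | rfl⟩
    · exact hM k (by omega)
    · exact hN k (by omega)

/-- For fixed $s<1$ the even partial sums increase to the generating function, so any one of them is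
a lower bound; by continuity it is still large for $s$ near $1$. -/
theorem tendsto_opGen_atTop {P : H →L[ℝ] H} (hP : P.IsSymmetric) (hc : ‖P‖ ≤ 1) (h : H)
    (hT : Tendsto (fun N => ∑ n ∈ Finset.range N, opCorr P h n) atTop atTop) :
    Tendsto (opGen P h) (𝓝[<] 1) atTop := by
  rw [tendsto_atTop]
  intro b
  obtain ⟨N, hN⟩ := eventually_atTop.mp (hT.eventually_ge_atTop (b + 1))
  have h1 := hN (2 * N) (by omega)
  have hcont : Continuous fun s : ℝ => ∑ n ∈ Finset.range (2 * N), s ^ n * opCorr P h n := by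
    fun_prop
  have h2 : ∀ᶠ s in 𝓝[<] (1 : ℝ), b < ∑ n ∈ Finset.range (2 * N), s ^ n * opCorr P h n := by
    refine nhdsWithin_le_nhds (hcont.tendsto 1 |>.eventually (lt_mem_nhds ?_))
    simp only [one_pow, one_mul]
    linarith
  have h3 : ∀ᶠ s in 𝓝[<] (1 : ℝ), 0 < s :=
    nhdsWithin_le_nhds (lt_mem_nhds one_pos)
  filter_upwards [h2, h3, self_mem_nhdsWithin] with s hs hs0 hs1
  refine hs.le.trans ?_
  have hmono := monotone_even_sum hP hc (s := s) ((abs_of_pos hs0).trans_le (le_of_lt hs1)) h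
  refine hmono.ge_of_tendsto ?_ N
  exact (summable_opGen hc h hs0.le hs1).hasSum.tendsto_sum_nat.comp
    (tendsto_id.const_mul_atTop' (by norm_num))

/-- The partial sums `1 + 2 ∑_{1 ≤ n ≤ N} ⟪h, Pⁿ h⟫`. -/
noncomputable def opIF (P : H →L[ℝ] H) (h : H) (N : ℕ) : ℝ :=
  1 + 2 * ∑ n ∈ Finset.Icc 1 N, opCorr P h n

theorem opIF_eq {P : H →L[ℝ] H} {h : H} (hh : ‖h‖ = 1) (N : ℕ) :
    opIF P h N = 2 * ∑ n ∈ Finset.range (N + 1), opCorr P h n - 1 := by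
  have h0 : opCorr P h 0 = 1 := by simp [opCorr, hh]
  rw [opIF, Finset.range_eq_Ico, Finset.sum_eq_sum_Ico_succ_bot (by omega), h0]
  have : Finset.Ico (0 + 1) (N + 1) = Finset.Icc 1 N := by ext; simp
  rw [this]; ring

theorem exists_tendsto_opIF [CompleteSpace H] {P : H →L[ℝ] H} (hP : P.IsSymmetric)
    (hc : ‖P‖ ≤ 1) (hne : ∀ v, P v = -v → v = 0) {h : H} (hh : ‖h‖ = 1) :
    ∃ v : EReal, Tendsto (fun N => (opIF P h N : EReal)) atTop (𝓝 v) := by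
  simp only [opIF_eq hh]
  rcases exists_tendsto_sum_opCorr hP hc hne h with ⟨l, hl⟩ | htop
  · refine ⟨((2 * l - 1 : ℝ) : EReal), EReal.tendsto_coe.mpr ?_⟩
    exact ((hl.comp (tendsto_add_atTop_nat 1)).const_mul 2).sub_const 1
  · refine ⟨⊤, EReal.tendsto_coe_nhds_top_iff.mpr ?_⟩
    exact tendsto_atTop_add_const_right _ (-1)
      ((htop.comp (tendsto_add_atTop_nat 1)).const_mul_atTop two_pos)

/-- Correlation sums of even length are nonnegative, so the sequence is at least $-1$ infinitely
often. -/
theorem not_tendsto_opIF_bot {P : H →L[ℝ] H} (hP : P.IsSymmetric) (hc : ‖P‖ ≤ 1) {h : H}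
    (hh : ‖h‖ = 1) : ¬ Tendsto (fun N => (opIF P h N : EReal)) atTop (𝓝 ⊥) := by
  intro hv
  rw [EReal.tendsto_coe_nhds_bot_iff] at hv
  obtain ⟨N, hN⟩ := eventually_atTop.mp (hv.eventually_le_atBot (-2))
  have h1 := hN (2 * N + 1) (by omega)
  have h2 : (0 : ℝ) ≤ ∑ n ∈ Finset.range (2 * (N + 1)), opCorr P h n := by
    simpa using monotone_even_sum hP hc (s := 1) (by simp) h (Nat.zero_le (N + 1))
  rw [show 2 * (N + 1) = 2 * N + 1 + 1 by omega] at h2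
  rw [opIF_eq hh] at h1
  linarith

/-- Abel summation of the inefficiency. -/
theorem tendsto_opGen_of_opIF {P : H →L[ℝ] H} (hP : P.IsSymmetric) (hc : ‖P‖ ≤ 1) {h : H}
    (hh : ‖h‖ = 1) {v : EReal} (hv : Tendsto (fun N => (opIF P h N : EReal)) atTop (𝓝 v)) :
    Tendsto (fun s => ((2 * opGen P h s - 1 : ℝ) : EReal)) (𝓝[<] 1) (𝓝 v) := by
  have key : ∀ N, ∑ n ∈ Finset.range (N + 1), opCorr P h n = (opIF P h N + 1) / 2 := by
    intro N; rw [opIF_eq hh]; ring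
  induction v with
  | bot => exact absurd hv (not_tendsto_opIF_bot hP hc hh)
  | coe l =>
    rw [EReal.tendsto_coe] at hv ⊢
    have h1 : Tendsto (fun N => ∑ n ∈ Finset.range N, opCorr P h n) atTop
        (𝓝 ((l + 1) / 2)) := by
      rw [← tendsto_add_atTop_iff_nat 1]
      simp only [key]
      exact (hv.add_const 1).div_const 2
    have h2 := Real.tendsto_tsum_powerSeries_nhdsWithin_lt h1
    have h3 : Tendsto (opGen P h) (𝓝[<] 1) (𝓝 ((l + 1) / 2)) :=
      h2.congr fun s => by simp only [opGen, mul_comm]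
    convert! (h3.const_mul 2).sub_const 1 using 2
    ring
  | top =>
    rw [EReal.tendsto_coe_nhds_top_iff] at hv ⊢
    have h1 : Tendsto (fun N => ∑ n ∈ Finset.range N, opCorr P h n) atTop atTop := by
      rw [← tendsto_add_atTop_iff_nat 1]
      simp only [key]
      exact (tendsto_atTop_add_const_right _ 1 hv).atTop_div_const two_pos
    exact tendsto_atTop_add_const_right _ (-1)
      ((tendsto_opGen_atTop hP hc h h1).const_mul_atTop two_pos)

theorem opIF_limit_le [CompleteSpace H] {P P' : H →L[ℝ] H} (hP : P.IsSymmetric)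
    (hP' : P'.IsSymmetric) (hc : ‖P‖ ≤ 1) (hc' : ‖P'‖ ≤ 1)
    (hle : ∀ f, ⟪f, P f⟫_ℝ ≤ ⟪f, P' f⟫_ℝ) {h : H} (hh : ‖h‖ = 1) {v v' : EReal}
    (hv : Tendsto (fun N => (opIF P h N : EReal)) atTop (𝓝 v))
    (hv' : Tendsto (fun N => (opIF P' h N : EReal)) atTop (𝓝 v')) : v ≤ v' := by
  refine le_of_tendsto_of_tendsto (tendsto_opGen_of_opIF hP hc hh hv)
    (tendsto_opGen_of_opIF hP' hc' hh hv') ?_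
  filter_upwards [nhdsWithin_le_nhds (lt_mem_nhds one_pos), self_mem_nhdsWithin] with s hs0 hs1
  have := opGen_le_opGen hP' hc hc' hle h (le_of_lt hs0) hs1
  exact_mod_cast (by linarith : 2 * opGen P h s - 1 ≤ 2 * opGen P' h s - 1)

theorem opIF_limit_lazy [CompleteSpace H] {P P' : H →L[ℝ] H} (hP : P.IsSymmetric)
    (hP' : P'.IsSymmetric) (hc : ‖P‖ ≤ 1) (hc' : ‖P'‖ ≤ 1) {a : ℝ} (ha0 : 0 < a)
    (hlazy : ∀ f, P' f = a • P f + (1 - a) • f) {h : H} (hh : ‖h‖ = 1) {v v' : EReal}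
    (hv : Tendsto (fun N => (opIF P h N : EReal)) atTop (𝓝 v))
    (hv' : Tendsto (fun N => (opIF P' h N : EReal)) atTop (𝓝 v')) :
    v' = (1 + v) / (a : EReal) - 1 := by
  have hA := tendsto_opGen_of_opIF hP hc hh hv
  have hA' := tendsto_opGen_of_opIF hP' hc' hh hv'
  have hd : Tendsto (fun s : ℝ => 1 - s + s * a) (𝓝[<] 1) (𝓝 a) := by
    have : Continuous fun s : ℝ => 1 - s + s * a := by fun_prop
    exact ((this.tendsto' 1 a (by ring)).mono_left nhdsWithin_le_nhds)
  -- The shifted argument $sa/(1-s+sa)$ also increases to $1$ from below, so the Abel limit for $P$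
  -- can be evaluated along it.
  have hs' : Tendsto (fun s : ℝ => s * a / (1 - s + s * a)) (𝓝[<] 1) (𝓝[<] 1) := by
    refine tendsto_nhdsWithin_iff.mpr ⟨?_, ?_⟩
    · have h1 : Tendsto (fun s : ℝ => s * a) (𝓝[<] 1) (𝓝 a) :=
        ((continuous_id.mul_const a).tendsto' 1 a (by simp)).mono_left nhdsWithin_le_nhds
      have h2 := h1.div hd ha0.ne'
      rw [div_self ha0.ne'] at h2
      exact h2
    · filter_upwards [nhdsWithin_le_nhds (lt_mem_nhds one_pos), self_mem_nhdsWithin]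
        with s hs0 hs1
      have hs0 : 0 < s := hs0
      have hs1 : s < 1 := hs1
      have : 0 < 1 - s + s * a := by nlinarith [mul_pos hs0 ha0]
      rw [Set.mem_Iio, div_lt_one this]
      linarith
  have hB := hA.comp hs'
  have heq : ∀ᶠ s in 𝓝[<] (1 : ℝ), 2 * opGen P' h s - 1 =
      ((2 * opGen P h (s * a / (1 - s + s * a)) - 1) + 1) / (1 - s + s * a) - 1 := by
    filter_upwards [nhdsWithin_le_nhds (lt_mem_nhds one_pos), self_mem_nhdsWithin]
      with s hs0 hs1
    rw [opGen_lazy hc hc' ha0 hlazy h (le_of_lt hs0) hs1]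
    ring
  refine tendsto_nhds_unique hA' ?_
  induction v with
  | bot => exact absurd hv (not_tendsto_opIF_bot hP hc hh)
  | coe l =>
    have h1 : (1 + (l : EReal)) / (a : EReal) - 1 = (((1 + l) / a - 1 : ℝ) : EReal) := by
      push_cast; rfl
    rw [h1, EReal.tendsto_coe]
    have h2 : Tendsto _ _ (𝓝 l) := EReal.tendsto_coe.mp hB
    have h3 := ((h2.add_const 1).div hd ha0.ne').sub_const 1
    rw [add_comm 1 l]
    exact h3.congr' (heq.mono fun s hs => hs.symm)
  | top =>
    have h1 : (1 + (⊤ : EReal)) / (a : EReal) - 1 = ⊤ := by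
      have : (1 : EReal) + ⊤ = ⊤ := by
        exact_mod_cast EReal.coe_add_top 1
      rw [this, EReal.top_div_of_pos_ne_top (by exact_mod_cast ha0) (EReal.coe_ne_top _)]
      exact_mod_cast EReal.top_sub_coe 1
    rw [h1, EReal.tendsto_coe_nhds_top_iff]
    have h2 : Tendsto _ _ atTop := EReal.tendsto_coe_nhds_top_iff.mp hB
    have h3 := tendsto_atTop_add_const_right _ (-1)
      ((tendsto_atTop_add_const_right _ 1 h2).atTop_mul_pos (inv_pos.mpr ha0)
        (hd.inv₀ ha0.ne'))
    exact h3.congr' (heq.mono fun s hs => by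
      simp only [hs, div_eq_mul_inv, sub_eq_add_neg])

end Hilbert

/-! ### The operator of an invariant Markov kernel on $L^2(\mu)$ -/

section KernelOperator

open scoped InnerProductSpace

variable {E : Type*} [MeasurableSpace E] {μ : Measure E} {K : Kernel E E}

theorem measurePreserving_fst_compProd (μ : Measure E) [IsFiniteMeasure μ] (K : Kernel E E)
    [IsMarkovKernel K] : MeasurePreserving Prod.fst (μ ⊗ₘ K) μ :=
  ⟨measurable_fst, Measure.fst_compProd μ K⟩

theorem measurePreserving_snd_compProd [IsFiniteMeasure μ] [IsMarkovKernel K]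
    (hK : K.Invariant μ) : MeasurePreserving Prod.snd (μ ⊗ₘ K) μ :=
  ⟨measurable_snd, (Measure.snd_compProd μ K).trans hK⟩

theorem measurePreserving_swap_compProd [IsFiniteMeasure μ] [IsMarkovKernel K]
    (hK : K.IsReversible μ) : MeasurePreserving Prod.swap (μ ⊗ₘ K) (μ ⊗ₘ K) := by
  refine ⟨measurable_swap, ?_⟩
  refine Measure.ext_prod fun {A B} hA hB => ?_
  rw [Measure.map_apply measurable_swap (hA.prod hB), Set.preimage_swap_prod,
    Measure.compProd_apply_prod hB hA, Measure.compProd_apply_prod hA hB]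
  exact hK hB hA

/-- The isometry `f ↦ ((x, y) ↦ f x)` from `L²(μ)` to `L²(μ ⊗ K)`. -/
noncomputable def fstL2 (μ : Measure E) [IsFiniteMeasure μ] (K : Kernel E E)
    [IsMarkovKernel K] : Lp ℝ 2 μ →ₗᵢ[ℝ] Lp ℝ 2 (μ ⊗ₘ K) :=
  Lp.compMeasurePreservingₗᵢ ℝ Prod.fst (measurePreserving_fst_compProd μ K)

/-- The isometry `f ↦ ((x, y) ↦ f y)` from `L²(μ)` to `L²(μ ⊗ K)`. -/
noncomputable def sndL2 [IsFiniteMeasure μ] [IsMarkovKernel K] (hK : K.Invariant μ) :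
    Lp ℝ 2 μ →ₗᵢ[ℝ] Lp ℝ 2 (μ ⊗ₘ K) :=
  Lp.compMeasurePreservingₗᵢ ℝ Prod.snd (measurePreserving_snd_compProd hK)

theorem fstL2_coe [IsFiniteMeasure μ] [IsMarkovKernel K] (f : Lp ℝ 2 μ) :
    fstL2 μ K f =ᵐ[μ ⊗ₘ K] fun z => f z.1 :=
  Lp.coeFn_compMeasurePreserving f (measurePreserving_fst_compProd μ K)

theorem sndL2_coe [IsFiniteMeasure μ] [IsMarkovKernel K] (hK : K.Invariant μ) (f : Lp ℝ 2 μ) :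
    sndL2 hK f =ᵐ[μ ⊗ₘ K] fun z => f z.2 :=
  Lp.coeFn_compMeasurePreserving f (measurePreserving_snd_compProd hK)

/-- The operator induced on `L²(μ)` by a Markov kernel that leaves `μ` invariant. -/
noncomputable def kerOp [IsFiniteMeasure μ] [IsMarkovKernel K] (hK : K.Invariant μ) :
    Lp ℝ 2 μ →L[ℝ] Lp ℝ 2 μ :=
  (fstL2 μ K).toContinuousLinearMap.adjoint ∘L (sndL2 hK).toContinuousLinearMap

theorem inner_kerOp [IsFiniteMeasure μ] [IsMarkovKernel K] (hK : K.Invariant μ)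
    (g f : Lp ℝ 2 μ) : ⟪g, kerOp hK f⟫_ℝ = ⟪fstL2 μ K g, sndL2 hK f⟫_ℝ := by
  rw [kerOp, ContinuousLinearMap.comp_apply, ContinuousLinearMap.adjoint_inner_right]
  rfl

theorem norm_kerOp_le [IsFiniteMeasure μ] [IsMarkovKernel K] (hK : K.Invariant μ) :
    ‖kerOp hK‖ ≤ 1 := by
  refine ContinuousLinearMap.opNorm_le_bound _ zero_le_one fun f => ?_
  rw [one_mul, kerOp, ContinuousLinearMap.comp_apply]
  refine (ContinuousLinearMap.le_opNorm _ _).trans ?_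
  rw [LinearIsometryEquiv.norm_map]
  calc _ ≤ 1 * ‖(sndL2 hK).toContinuousLinearMap f‖ := by
        gcongr
        exact (fstL2 μ K).norm_toContinuousLinearMap_le
    _ = ‖f‖ := by rw [one_mul]; exact (sndL2 hK).norm_map f

theorem inner_kerOp_eq_integral [IsFiniteMeasure μ] [IsMarkovKernel K] (hK : K.Invariant μ)
    (g f : Lp ℝ 2 μ) : ⟪g, kerOp hK f⟫_ℝ = ∫ z, g z.1 * f z.2 ∂(μ ⊗ₘ K) := by
  rw [inner_kerOp, L2.inner_def]
  refine integral_congr_ae ?_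
  filter_upwards [fstL2_coe (K := K) g, sndL2_coe hK f] with z h1 h2
  rw [h1, h2]
  simp [mul_comm]

/-- Reversibility says that the law of $(X_0,X_1)$ is invariant under swapping coordinates. -/
theorem isSymmetric_kerOp [IsFiniteMeasure μ] [IsMarkovKernel K] (hK : K.Invariant μ)
    (hrev : K.IsReversible μ) : (kerOp hK).IsSymmetric := by
  intro f g
  have h1 := (measurePreserving_swap_compProd hrev).integral_comp
    MeasurableEquiv.prodComm.measurableEmbedding (fun z : E × E => g z.1 * f z.2)
  change ⟪kerOp hK f, g⟫_ℝ = ⟪f, kerOp hK g⟫_ℝ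
  rw [real_inner_comm, inner_kerOp_eq_integral, inner_kerOp_eq_integral, ← h1]
  simp [mul_comm]

/-- The operator is built abstractly as an adjoint; testing against indicators identifies it with
integration against the kernel. -/
theorem kerOp_coe [IsFiniteMeasure μ] [IsMarkovKernel K] (hK : K.Invariant μ)
    (f : Lp ℝ 2 μ) : kerOp hK f =ᵐ[μ] fun x => ∫ y, f y ∂(K x) := by
  have hfi : Integrable f μ := (Lp.memLp f).integrable one_le_two
  have hfi' : Integrable f (K ∘ₘ μ) := by rwa [hK.def]
  have hint : Integrable (fun x => ∫ y, f y ∂(K x)) μ := by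
    rw [Measure.comp_eq_comp_const_apply] at hfi'
    simpa using hfi'.integral_comp
  refine Integrable.ae_eq_of_forall_setIntegral_eq _ _
    ((Lp.memLp _).integrable one_le_two) hint fun A hA _ => ?_
  have h1 := inner_kerOp_eq_integral hK (indicatorConstLp 2 hA (measure_ne_top μ A) (1 : ℝ)) f
  rw [L2.inner_indicatorConstLp_one] at h1
  rw [h1]
  have h2 : ∫ z, (indicatorConstLp 2 hA (measure_ne_top μ A) (1 : ℝ)) z.1 * f z.2 ∂(μ ⊗ₘ K) =
      ∫ z in A ×ˢ Set.univ, f z.2 ∂(μ ⊗ₘ K) := by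
    rw [← integral_indicator (hA.prod .univ)]
    refine integral_congr_ae ?_
    filter_upwards [(measurePreserving_fst_compProd μ K).quasiMeasurePreserving.ae_eq_comp
      (indicatorConstLp_coeFn (p := 2) (hs := hA) (hμs := measure_ne_top μ A) (c := (1 : ℝ)))]
      with z hz
    simp only [Function.comp_apply] at hz
    rw [hz]
    by_cases h : z.1 ∈ A <;> simp [h]
  rw [h2, Measure.setIntegral_compProd hA .univ]
  · simp
  · exact ((measurePreserving_snd_compProd hK).integrable_comp_of_integrable hfi).integrableOn

theorem kerOp_toLp [IsFiniteMeasure μ] [IsMarkovKernel K] (hK : K.Invariant μ) {f : E → ℝ}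
    (hf : MemLp f 2 μ) : kerOp hK (hf.toLp f) =ᵐ[μ] fun x => ∫ y, f y ∂(K x) := by
  refine (kerOp_coe hK _).trans ?_
  have h1 : ∀ᵐ y ∂(K ∘ₘ μ), hf.toLp f y = f y := by
    rw [hK.def]; exact hf.coeFn_toLp
  filter_upwards [Measure.ae_ae_of_ae_comp h1] with x hx
  exact integral_congr_ae hx

theorem iterApply_ae_eq [IsFiniteMeasure μ] [IsMarkovKernel K] (hK : K.Invariant μ) {f : E → ℝ}
    (hf : MemLp f 2 μ) (n : ℕ) :
    ((kerOp hK ^ n) (hf.toLp f) : Lp ℝ 2 μ) =ᵐ[μ] iterApply K n f := by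
  have hinv : ∀ n : ℕ, (K ^ n).Invariant μ := by
    intro n
    induction n with
    | zero => rw [pow_zero]; exact Measure.id_comp
    | succ n ih => rw [pow_succ]; exact ih.comp hK
  induction n with
  | zero =>
    refine hf.coeFn_toLp.trans ?_
    -- $K^0(x,\cdot)$ is a Dirac mass, and $f$ is only a.e. strongly measurable, so the integral is
    -- evaluated on a measurable representative.
    have h1 : ∀ᵐ y ∂((Kernel.id : Kernel E E) ∘ₘ μ), f y = hf.1.mk f y := by
      rw [Measure.id_comp]; exact hf.1.ae_eq_mk
    filter_upwards [Measure.ae_ae_of_ae_comp h1, hf.1.ae_eq_mk] with x hx hx'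
    have h2 : iterApply K 0 f x = ∫ y, f y ∂(Kernel.id x) := rfl
    rw [h2, integral_congr_ae hx, Kernel.id_apply,
      integral_dirac' _ _ hf.1.stronglyMeasurable_mk, hx']
  | succ n ih =>
    have hm : MemLp (iterApply K n f) 2 μ := (memLp_congr_ae ih).mp (Lp.memLp _)
    have h1 : (kerOp hK ^ n) (hf.toLp f) = hm.toLp _ := by
      ext1
      exact ih.trans hm.coeFn_toLp.symm
    rw [pow_succ']
    change kerOp hK ((kerOp hK ^ n) (hf.toLp f)) =ᵐ[μ] _
    rw [h1]
    refine (kerOp_toLp hK hm).trans ?_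
    have hfi : Integrable f ((K ^ (n + 1) : Kernel E E) ∘ₘ μ) := by
      rw [(hinv _).def]; exact hf.integrable one_le_two
    filter_upwards [Measure.ae_integrable_of_integrable_comp hfi] with x hx
    have h2 : (K ^ (n + 1)) = (K ^ n) ∘ₖ K := pow_succ K n
    rw [iterApply, h2]
    rw [h2] at hx
    exact (Kernel.integral_comp hx).symm

theorem ofReal_norm_sq_eq_lintegral {F : Type*} [MeasurableSpace F] {ρ : Measure F}
    (f : Lp ℝ 2 ρ) : ENNReal.ofReal (‖f‖ ^ 2) = ∫⁻ z, ENNReal.ofReal (f z ^ 2) ∂ρ := by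
  rw [← real_inner_self_eq_norm_sq, L2.inner_def, ofReal_integral_eq_lintegral_ofReal
    (L2.integrable_inner f f) (ae_of_all _ fun z => real_inner_self_nonneg)]
  congr 1 with z
  rw [real_inner_self_eq_norm_sq, Real.norm_eq_abs, sq_abs]

/-- The Dirichlet form is the squared norm of $f(x)-f(y)$ in $L^2(\mu\otimes K)$; both coordinate
embeddings are isometries. -/
theorem ofReal_energy_sub [IsFiniteMeasure μ] [IsMarkovKernel K] (hK : K.Invariant μ)
    (f : Lp ℝ 2 μ) : ENNReal.ofReal (2 * (‖f‖ ^ 2 - ⟪f, kerOp hK f⟫_ℝ)) =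
      ∫⁻ z, ENNReal.ofReal ((f z.1 - f z.2) ^ 2) ∂(μ ⊗ₘ K) := by
  have h1 : 2 * (‖f‖ ^ 2 - ⟪f, kerOp hK f⟫_ℝ) = ‖fstL2 μ K f - sndL2 hK f‖ ^ 2 := by
    rw [norm_sub_sq_real, inner_kerOp, LinearIsometry.norm_map, LinearIsometry.norm_map]
    ring
  rw [h1, ofReal_norm_sq_eq_lintegral]
  refine lintegral_congr_ae ?_
  filter_upwards [fstL2_coe (K := K) f, sndL2_coe hK f,
    Lp.coeFn_sub (fstL2 μ K f) (sndL2 hK f)] with z h1 h2 h3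
  rw [h3, Pi.sub_apply, h1, h2]

theorem ofReal_energy_add [IsFiniteMeasure μ] [IsMarkovKernel K] (hK : K.Invariant μ)
    (f : Lp ℝ 2 μ) : ENNReal.ofReal (2 * (‖f‖ ^ 2 + ⟪f, kerOp hK f⟫_ℝ)) =
      ∫⁻ z, ENNReal.ofReal ((f z.1 + f z.2) ^ 2) ∂(μ ⊗ₘ K) := by
  have h1 : 2 * (‖f‖ ^ 2 + ⟪f, kerOp hK f⟫_ℝ) = ‖fstL2 μ K f + sndL2 hK f‖ ^ 2 := by
    rw [norm_add_sq_real, inner_kerOp, LinearIsometry.norm_map, LinearIsometry.norm_map]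
    ring
  rw [h1, ofReal_norm_sq_eq_lintegral]
  refine lintegral_congr_ae ?_
  filter_upwards [fstL2_coe (K := K) f, sndL2_coe hK f,
    Lp.coeFn_add (fstL2 μ K f) (sndL2 hK f)] with z h1 h2 h3
  rw [h3, Pi.add_apply, h1, h2]

theorem inner_kerOp_le_of_energy_le {K' : Kernel E E} [IsFiniteMeasure μ] [IsMarkovKernel K]
    [IsMarkovKernel K'] (hK : K.Invariant μ) (hK' : K'.Invariant μ) {f : Lp ℝ 2 μ}
    (hle : ∫⁻ z, ENNReal.ofReal ((f z.1 - f z.2) ^ 2) ∂(μ ⊗ₘ K') ≤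
      ∫⁻ z, ENNReal.ofReal ((f z.1 - f z.2) ^ 2) ∂(μ ⊗ₘ K)) :
    ⟪f, kerOp hK f⟫_ℝ ≤ ⟪f, kerOp hK' f⟫_ℝ := by
  rw [← ofReal_energy_sub hK, ← ofReal_energy_sub hK', ENNReal.ofReal_le_ofReal_iff'] at hle
  have h1 : ⟪f, kerOp hK f⟫_ℝ ≤ ‖f‖ ^ 2 := by
    have := real_inner_le_norm f (kerOp hK f)
    nlinarith [norm_apply_le_self (norm_kerOp_le hK) f, norm_nonneg f]
  have h2 : ⟪f, kerOp hK' f⟫_ℝ ≤ ‖f‖ ^ 2 := by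
    have := real_inner_le_norm f (kerOp hK' f)
    nlinarith [norm_apply_le_self (norm_kerOp_le hK') f, norm_nonneg f]
  rcases hle with hle | hle <;> linarith

/-! ### Autocorrelations -/

theorem kerOp_toLp_const [IsFiniteMeasure μ] [IsMarkovKernel K] (hK : K.Invariant μ) (c : ℝ)
    (n : ℕ) : (kerOp hK ^ n) ((memLp_const c).toLp fun _ : E => c) =
      (memLp_const c).toLp fun _ : E => c := by
  induction n with
  | zero => rfl
  | succ n ih =>
    rw [pow_succ']
    change kerOp hK ((kerOp hK ^ n) _) = _
    rw [ih]
    ext1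
    refine (kerOp_toLp hK _).trans (EventuallyEq.trans ?_ (memLp_const c).coeFn_toLp.symm)
    simp

theorem memLp_centred [IsProbabilityMeasure μ] {h : E → ℝ} (hh : MemLp h 2 μ) :
    MemLp (centred μ h) 2 μ := hh.sub (memLp_const _)

theorem norm_sq_toLp {f : E → ℝ} (hf : MemLp f 2 μ) :
    ‖hf.toLp f‖ ^ 2 = ∫ x, f x ^ 2 ∂μ := by
  rw [← real_inner_self_eq_norm_sq, L2.inner_def]
  refine integral_congr_ae ?_
  filter_upwards [hf.coeFn_toLp] with x hx
  rw [real_inner_self_eq_norm_sq, Real.norm_eq_abs, sq_abs, hx]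

theorem integral_centred [IsProbabilityMeasure μ] {h : E → ℝ} (hh : MemLp h 2 μ) :
    ∫ x, centred μ h x ∂μ = 0 := by
  simp only [centred]
  rw [integral_sub (hh.integrable one_le_two) (integrable_const _)]
  simp

theorem autocorr_eq [IsProbabilityMeasure μ] [IsMarkovKernel K] (hK : K.Invariant μ)
    {h : E → ℝ} (hh : MemLp h 2 μ) (n : ℕ) :
    autocorr μ K h n =
      opCorr (kerOp hK) ((memLp_centred hh).toLp _) n / ‖(memLp_centred hh).toLp _‖ ^ 2 := by
  rw [autocorr, norm_sq_toLp]
  congr 1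
  set m := ∫ y, h y ∂μ with hm
  -- The iterate is applied to $h$ and not to $\bar h$; the difference is a constant, which $K^n$
  -- fixes and which is orthogonal to $\bar h$.
  have h1 : hh.toLp h = (memLp_centred hh).toLp _ + (memLp_const m).toLp fun _ : E => m := by
    rw [← MemLp.toLp_add]
    congr 1
    ext x
    simp [centred, hm]
  have h2 : iterApply K n h =ᵐ[μ] fun x =>
      (kerOp hK ^ n) ((memLp_centred hh).toLp _) x + m := by
    refine (iterApply_ae_eq hK hh n).symm.trans ?_
    rw [h1, map_add, kerOp_toLp_const]
    filter_upwards [Lp.coeFn_add ((kerOp hK ^ n) ((memLp_centred hh).toLp _))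
      ((memLp_const m).toLp fun _ : E => m), (memLp_const (p := 2) (μ := μ) m).coeFn_toLp]
      with x hx hx'
    rw [hx, Pi.add_apply, hx']
  have h3 : Integrable (fun x => centred μ h x * (kerOp hK ^ n) ((memLp_centred hh).toLp _) x)
      μ := (memLp_centred hh).integrable_mul (Lp.memLp _)
  calc ∫ x, centred μ h x * iterApply K n h x ∂μ
      = ∫ x, (centred μ h x * (kerOp hK ^ n) ((memLp_centred hh).toLp _) x +
          centred μ h x * m) ∂μ := by
        refine integral_congr_ae ?_
        filter_upwards [h2] with x hx
        rw [hx, mul_add]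
    _ = ∫ x, centred μ h x * (kerOp hK ^ n) ((memLp_centred hh).toLp _) x ∂μ := by
        rw [integral_add h3 (((memLp_centred hh).integrable one_le_two).mul_const m),
          integral_mul_const, integral_centred hh, zero_mul, add_zero]
    _ = _ := by
        rw [opCorr, L2.inner_def]
        refine integral_congr_ae ?_
        filter_upwards [(memLp_centred hh).coeFn_toLp] with x hx
        rw [hx]
        simp [mul_comm]

/-- The normalised version of `h - μ(h)` in `L²(μ)`. -/
noncomputable def unitCentred [IsProbabilityMeasure μ] {h : E → ℝ} (hh : MemLp h 2 μ) :
    Lp ℝ 2 μ := ‖(memLp_centred hh).toLp _‖⁻¹ • (memLp_centred hh).toLp _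

theorem norm_unitCentred [IsProbabilityMeasure μ] {h : E → ℝ} (hh : MemLp h 2 μ)
    (hpos : 0 < ∫ x, centred μ h x ^ 2 ∂μ) : ‖unitCentred hh‖ = 1 := by
  rw [← norm_sq_toLp (memLp_centred hh)] at hpos
  rw [unitCentred, norm_smul, norm_inv, norm_norm]
  refine inv_mul_cancel₀ fun h0 => ?_
  simp [h0] at hpos

theorem hasIF_iff [IsProbabilityMeasure μ] [IsMarkovKernel K] (hK : K.Invariant μ)
    {h : E → ℝ} (hh : MemLp h 2 μ) {v : EReal} :
    HasIF μ K h v ↔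
      Tendsto (fun N => (opIF (kerOp hK) (unitCentred hh) N : EReal)) atTop (𝓝 v) := by
  have h1 : ∀ n, autocorr μ K h n = opCorr (kerOp hK) (unitCentred hh) n := by
    intro n
    rw [autocorr_eq hK hh, opCorr, opCorr, unitCentred, map_smul, inner_smul_left,
      inner_smul_right]
    simp only [conj_trivial]
    rw [div_eq_inv_mul, sq, mul_inv, mul_assoc]
  simp only [HasIF, opIF, h1]

end KernelOperator

/-! ### Metropolis–Hastings kernels: reversibility, Peskun ordering, laziness -/

section MetropolisHastings

open scoped InnerProductSpace

variable {Θ : Type*} [MeasurableSpace Θ] {ν : Measure Θ} {p : Θ → ℝ≥0}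
  {q : Θ → Θ → ℝ≥0} {α : Θ → Θ → ℝ≥0∞}

theorem isProbabilityMeasure_target (hp1 : ∫⁻ θ, (p θ : ℝ≥0∞) ∂ν = 1) :
    IsProbabilityMeasure (target ν p) := by
  refine ⟨?_⟩
  rwa [target, withDensity_apply _ .univ, Measure.restrict_univ]

theorem measurable_mul_accept (hq : Measurable (Function.uncurry q))
    (hα : Measurable (Function.uncurry α)) :
    Measurable (Function.uncurry fun θ θ' => (q θ θ' : ℝ≥0∞) * α θ θ') :=
  (measurable_coe_nnreal_ennreal.comp hq).mul hα

theorem measurable_mul_accept_right (hq : Measurable (Function.uncurry q))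
    (hα : Measurable (Function.uncurry α)) (θ : Θ) :
    Measurable fun θ' => (q θ θ' : ℝ≥0∞) * α θ θ' :=
  (measurable_mul_accept hq hα).comp measurable_prodMk_left

theorem accProb_le_one (hq1 : ∀ θ, ∫⁻ θ', (q θ θ' : ℝ≥0∞) ∂ν = 1) (hα1 : ∀ x y, α x y ≤ 1)
    (θ : Θ) : accProb ν q α θ ≤ 1 := by
  rw [← hq1 θ]
  exact lintegral_mono fun y => mul_le_of_le_one_right' (hα1 θ y)

/-- Otherwise $q(\theta,\cdot)(1-\alpha)$ integrates to $0$, so $q(\theta,\cdot)=0$ a.e., against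
its total mass $1$. -/
theorem accProb_lt_one (hq : Measurable (Function.uncurry q))
    (hq1 : ∀ θ, ∫⁻ θ', (q θ θ' : ℝ≥0∞) ∂ν = 1)
    (hα : Measurable (Function.uncurry α)) (hα1 : ∀ x y, α x y < 1) (θ : Θ) :
    accProb ν q α θ < 1 := by
  refine (accProb_le_one hq1 (fun x y => (hα1 x y).le) θ).lt_of_ne fun h1 => ?_
  have hm1 : Measurable fun y => (q θ y : ℝ≥0∞) * α θ y :=
    measurable_mul_accept_right hq hα θ
  have hmα : Measurable (α θ) := hα.comp measurable_prodMk_left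
  have hmq : Measurable fun y => (q θ y : ℝ≥0∞) :=
    measurable_coe_nnreal_ennreal.comp (hq.comp measurable_prodMk_left)
  have h2 : ∫⁻ y, (q θ y : ℝ≥0∞) ∂ν =
      accProb ν q α θ + ∫⁻ y, (q θ y : ℝ≥0∞) * (1 - α θ y) ∂ν := by
    rw [accProb, ← lintegral_add_left hm1]
    congr 1 with y
    rw [← mul_add, add_tsub_cancel_of_le (hα1 θ y).le, mul_one]
  rw [hq1, h1] at h2
  have h3 : ∫⁻ y, (q θ y : ℝ≥0∞) * (1 - α θ y) ∂ν = 0 := by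
    have h4 : (1 : ℝ≥0∞) + ∫⁻ y, (q θ y : ℝ≥0∞) * (1 - α θ y) ∂ν = 1 + 0 := by
      rw [← h2, add_zero]
    exact (ENNReal.add_right_inj ENNReal.one_ne_top).mp h4
  rw [lintegral_eq_zero_iff (show Measurable fun y => (q θ y : ℝ≥0∞) * (1 - α θ y) from
    hmq.mul (measurable_const.sub hmα))] at h3
  have h4 : ∫⁻ y, (q θ y : ℝ≥0∞) ∂ν = 0 := by
    rw [lintegral_eq_zero_iff hmq]
    filter_upwards [h3] with y hy
    rcases mul_eq_zero.mp hy with hy | hy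
    · exact hy
    · exact absurd (hα1 θ y) (not_lt.mpr (tsub_eq_zero_iff_le.mp hy))
  rw [hq1] at h4
  exact one_ne_zero h4

variable [SigmaFinite ν]

theorem measurable_accProb (hq : Measurable (Function.uncurry q))
    (hα : Measurable (Function.uncurry α)) : Measurable (accProb ν q α) :=
  (measurable_mul_accept hq hα).lintegral_prod_right'

theorem isMarkovKernel_mhKernel (hq : Measurable (Function.uncurry q))
    (hq1 : ∀ θ, ∫⁻ θ', (q θ θ' : ℝ≥0∞) ∂ν = 1)
    (hα : Measurable (Function.uncurry α)) (hα1 : ∀ x y, α x y ≤ 1) :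
    IsMarkovKernel (mhKernel ν q α) := by
  refine ⟨fun θ => ⟨?_⟩⟩
  rw [mhKernel_apply ν hq hα]
  simp only [Measure.add_apply, Measure.smul_apply, smul_eq_mul, measure_univ, mul_one,
    withDensity_apply _ MeasurableSet.univ, Measure.restrict_univ]
  exact add_tsub_cancel_of_le (accProb_le_one hq1 hα1 θ)

theorem lintegral_mhKernel (hq : Measurable (Function.uncurry q))
    (hα : Measurable (Function.uncurry α)) (θ : Θ) {g : Θ → ℝ≥0∞} (hg : Measurable g) :
    ∫⁻ y, g y ∂(mhKernel ν q α θ) =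
      ∫⁻ y, (q θ y : ℝ≥0∞) * α θ y * g y ∂ν + (1 - accProb ν q α θ) * g θ := by
  rw [mhKernel_apply ν hq hα, lintegral_add_measure, lintegral_smul_measure,
    lintegral_dirac' _ hg, smul_eq_mul, lintegral_withDensity_eq_lintegral_mul _ _ hg]
  · rfl
  · exact measurable_mul_accept_right hq hα θ

/-- The accepted flow is symmetric by detailed balance and Tonelli; the rejected flow from $A$ to
$B$ lives on $A\cap B$, hence is symmetric for any $\alpha$. -/
theorem isReversible_mhKernel (hp : Measurable p) (hq : Measurable (Function.uncurry q))
    (hα : Measurable (Function.uncurry α))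
    (hsymm : ∀ x y, (p x : ℝ≥0∞) * (q x y * α x y) = p y * (q y x * α y x)) :
    (mhKernel ν q α).IsReversible (target ν p) := by
  have hF := measurable_mul_accept hq hα
  have key : ∀ A B : Set Θ, MeasurableSet A → MeasurableSet B →
      ∫⁻ x in A, mhKernel ν q α x B ∂(target ν p) =
        ∫⁻ x in A, ∫⁻ y in B, (p x : ℝ≥0∞) * (q x y * α x y) ∂ν ∂ν +
          ∫⁻ x in A ∩ B, (1 - accProb ν q α x) ∂(target ν p) := by
    intro A B hA hB
    have h1 : ∀ x, mhKernel ν q α x B = ∫⁻ y in B, (q x y : ℝ≥0∞) * α x y ∂ν +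
        B.indicator (fun x => 1 - accProb ν q α x) x := by
      intro x
      rw [mhKernel_apply ν hq hα, Measure.add_apply, Measure.smul_apply,
        Measure.dirac_apply' _ hB, withDensity_apply _ hB]
      congr 1
      by_cases hx : x ∈ B <;> simp [hx]
    simp only [h1]
    have hm : Measurable fun x => ∫⁻ y in B, (q x y : ℝ≥0∞) * α x y ∂ν :=
      hF.lintegral_prod_right'
    rw [lintegral_add_left hm, setLIntegral_indicator hB, Set.inter_comm B A]
    congr 1
    rw [target, setLIntegral_withDensity_eq_setLIntegral_mul _ hp.coe_nnreal_ennreal hm hA]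
    refine lintegral_congr fun x => ?_
    rw [Pi.mul_apply, lintegral_const_mul _ (measurable_mul_accept_right hq hα x)]
  intro A B hA hB
  rw [key A B hA hB, key B A hB hA, Set.inter_comm B A]
  congr 1
  rw [lintegral_lintegral_swap]
  · simp only [hsymm]
  · exact (((measurable_coe_nnreal_ennreal.comp hp).comp measurable_fst).mul hF).aemeasurable

theorem lintegral_compProd_mhKernel [SFinite (target ν p)] [IsMarkovKernel (mhKernel ν q α)]
    (hq : Measurable (Function.uncurry q)) (hα : Measurable (Function.uncurry α))
    {G : Θ × Θ → ℝ≥0∞} (hG : Measurable G) (hG0 : ∀ x, G (x, x) = 0) :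
    ∫⁻ z, G z ∂(target ν p ⊗ₘ mhKernel ν q α) =
      ∫⁻ x, ∫⁻ y, (q x y : ℝ≥0∞) * α x y * G (x, y) ∂ν ∂(target ν p) := by
  rw [Measure.lintegral_compProd hG]
  refine lintegral_congr fun x => ?_
  rw [lintegral_mhKernel hq hα x (g := fun y => G (x, y)) (hG.comp measurable_prodMk_left)]
  simp [hG0]

/-- Peskun's argument: $(f(x)-f(y))^2$ vanishes on the diagonal, so rejections do not contribute and
the Dirichlet form is monotone in $\alpha$. -/
theorem inner_kerOp_mhKernel_le {α' : Θ → Θ → ℝ≥0∞} [IsFiniteMeasure (target ν p)]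
    [IsMarkovKernel (mhKernel ν q α)] [IsMarkovKernel (mhKernel ν q α')]
    (hq : Measurable (Function.uncurry q)) (hα : Measurable (Function.uncurry α))
    (hα' : Measurable (Function.uncurry α')) (hK : (mhKernel ν q α).Invariant (target ν p))
    (hK' : (mhKernel ν q α').Invariant (target ν p)) (hle : ∀ x y, α' x y ≤ α x y)
    (f : Lp ℝ 2 (target ν p)) : ⟪f, kerOp hK f⟫_ℝ ≤ ⟪f, kerOp hK' f⟫_ℝ := by
  refine inner_kerOp_le_of_energy_le hK hK' ?_
  have hf : Measurable f := (Lp.stronglyMeasurable f).measurable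
  have hG : Measurable fun z : Θ × Θ => ENNReal.ofReal ((f z.1 - f z.2) ^ 2) := by fun_prop
  rw [lintegral_compProd_mhKernel hq hα hG (by simp),
    lintegral_compProd_mhKernel hq hα' hG (by simp)]
  refine lintegral_mono fun x => lintegral_mono fun y => ?_
  dsimp only
  gcongr
  exact hle x y

/-- A kernel that rejects with positive probability from every point does not have the
eigenvalue `-1`. -/
theorem eq_zero_of_kerOp_mhKernel_eq_neg [IsFiniteMeasure (target ν p)]
    [IsMarkovKernel (mhKernel ν q α)] (hq : Measurable (Function.uncurry q))
    (hq1 : ∀ θ, ∫⁻ θ', (q θ θ' : ℝ≥0∞) ∂ν = 1)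
    (hα : Measurable (Function.uncurry α)) (hα1 : ∀ x y, α x y < 1)
    (hK : (mhKernel ν q α).Invariant (target ν p)) (f : Lp ℝ 2 (target ν p))
    (hf : kerOp hK f = -f) : f = 0 := by
  have hfm : Measurable f := (Lp.stronglyMeasurable f).measurable
  have hG : Measurable fun z : Θ × Θ => ENNReal.ofReal ((f z.1 + f z.2) ^ 2) := by fun_prop
  have h1 := ofReal_energy_add hK f
  rw [hf, inner_neg_right, real_inner_self_eq_norm_sq, add_neg_cancel, mul_zero,
    ENNReal.ofReal_zero, Measure.lintegral_compProd hG] at h1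
  -- If $Pf=-f$ then $\int(f(x)+f(y))^2=0$; only the diagonal part coming from rejections is kept.
  have h2 : ∫⁻ x, (1 - accProb ν q α x) * ENNReal.ofReal ((f x + f x) ^ 2) ∂(target ν p) = 0 := by
    refine le_antisymm ?_ zero_le
    rw [h1]
    refine lintegral_mono fun x => ?_
    rw [lintegral_mhKernel hq hα x (g := fun y => ENNReal.ofReal ((f x + f y) ^ 2))
      (hG.comp measurable_prodMk_left)]
    exact le_add_self
  rw [lintegral_eq_zero_iff (by
    exact (measurable_const.sub (measurable_accProb hq hα)).mul (by fun_prop))] at h2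
  rw [Lp.eq_zero_iff_ae_eq_zero]
  filter_upwards [h2] with x hx
  rcases mul_eq_zero.mp hx with hx | hx
  · exact absurd (accProb_lt_one hq hq1 hα hα1 x) (not_lt.mpr (tsub_eq_zero_iff_le.mp hx))
  · have h3 : (f x + f x) ^ 2 = 0 := le_antisymm (ENNReal.ofReal_eq_zero.mp hx) (sq_nonneg _)
    have h4 := pow_eq_zero_iff two_ne_zero |>.mp h3
    simp only [Pi.zero_apply]
    linarith

theorem lazyKernel_mhKernel {a : ℝ} (ha0 : 0 ≤ a) (ha1 : a ≤ 1)
    (hq : Measurable (Function.uncurry q)) (hq1 : ∀ θ, ∫⁻ θ', (q θ θ' : ℝ≥0∞) ∂ν = 1)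
    (hα : Measurable (Function.uncurry α)) (hα1 : ∀ x y, α x y ≤ 1) :
    lazyKernel a (mhKernel ν q α) = mhKernel ν q fun x y => ENNReal.ofReal a * α x y := by
  have hα' : Measurable (Function.uncurry fun x y => ENNReal.ofReal a * α x y) :=
    hα.const_mul _
  ext θ s hs
  change (ENNReal.ofReal a • mhKernel ν q α θ + ENNReal.ofReal (1 - a) • Measure.dirac θ) s = _
  have h1 : accProb ν q (fun x y => ENNReal.ofReal a * α x y) θ =
      ENNReal.ofReal a * accProb ν q α θ := by
    rw [accProb, accProb, ← lintegral_const_mul _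
      (measurable_mul_accept_right hq hα θ)]
    congr 1 with y
    ring
  have h2 : ∫⁻ y in s, (q θ y : ℝ≥0∞) * (ENNReal.ofReal a * α θ y) ∂ν =
      ENNReal.ofReal a * ∫⁻ y in s, (q θ y : ℝ≥0∞) * α θ y ∂ν := by
    rw [← lintegral_const_mul _ (measurable_mul_accept_right hq hα θ)]
    congr 1 with y
    ring
  have h3 : 1 - ENNReal.ofReal a * accProb ν q α θ =
      ENNReal.ofReal a * (1 - accProb ν q α θ) + ENNReal.ofReal (1 - a) := by
    have hA := accProb_le_one hq1 hα1 θ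
    lift accProb ν q α θ to ℝ≥0 using ne_top_of_le_ne_top ENNReal.one_ne_top hA with b
    have hb : (b : ℝ) ≤ 1 := by exact_mod_cast hA
    rw [← ENNReal.ofReal_coe_nnreal, ← ENNReal.ofReal_one, ← ENNReal.ofReal_mul ha0,
      ← ENNReal.ofReal_sub _ (by positivity), ← ENNReal.ofReal_sub _ (by positivity),
      ← ENNReal.ofReal_mul ha0, ← ENNReal.ofReal_add (mul_nonneg ha0 (by linarith))
        (by linarith)]
    congr 1
    ring
  rw [mhKernel_apply ν hq hα, mhKernel_apply ν hq hα', h1, h3]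
  simp only [Measure.add_apply, Measure.smul_apply, smul_eq_mul, withDensity_apply _ hs, h2]
  ring

theorem kerOp_lazyKernel {E : Type*} [MeasurableSpace E] {μ : Measure E} [IsFiniteMeasure μ]
    {a : ℝ} (ha0 : 0 ≤ a) (ha1 : a ≤ 1) {K : Kernel E E} [IsMarkovKernel K]
    [IsMarkovKernel (lazyKernel a K)] (hK : K.Invariant μ)
    (hK' : (lazyKernel a K).Invariant μ) (f : Lp ℝ 2 μ) :
    kerOp hK' f = a • kerOp hK f + (1 - a) • f := by
  ext1
  have hfi : Integrable f (K ∘ₘ μ) := by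
    rw [hK.def]; exact (Lp.memLp f).integrable one_le_two
  filter_upwards [kerOp_coe hK' f, kerOp_coe hK f, Measure.ae_integrable_of_integrable_comp hfi,
    Lp.coeFn_add (a • kerOp hK f) ((1 - a) • f), Lp.coeFn_smul a (kerOp hK f),
    Lp.coeFn_smul (1 - a) f] with x h1 h2 h3 h4 h5 h6
  rw [h1, h4, Pi.add_apply, h5, h6, Pi.smul_apply, Pi.smul_apply, h2]
  change ∫ y, f y ∂(ENNReal.ofReal a • K x + ENNReal.ofReal (1 - a) • Measure.dirac x) = _
  have hd : Integrable f (Measure.dirac x) := integrable_dirac' (Lp.stronglyMeasurable f) (by simp)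
  rw [integral_add_measure (h3.smul_measure ENNReal.ofReal_ne_top)
    (hd.smul_measure ENNReal.ofReal_ne_top), integral_smul_measure, integral_smul_measure,
    integral_dirac' _ _ (Lp.stronglyMeasurable f), ENNReal.toReal_ofReal ha0,
    ENNReal.toReal_ofReal (by linarith)]

end MetropolisHastings

/-! ### Gaussian noise: tilting, detailed balance and the value of $\varrho_U$ -/

section Noise

variable {κ : ℝ}

theorem toNNReal_sq_ne_zero (hκ : 0 < κ) : (κ ^ 2).toNNReal ≠ 0 := by
  simpa using hκ.ne'

instance isProbabilityMeasure_noise : IsProbabilityMeasure (noise κ) := by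
  unfold noise; infer_instance

theorem exp_mul_gaussianPDFReal_noise (hκ : 0 < κ) (w : ℝ) :
    Real.exp w * gaussianPDFReal (-(κ ^ 2) / 2) (κ ^ 2).toNNReal w =
      gaussianPDFReal (-(κ ^ 2) / 2) (κ ^ 2).toNNReal (-w) := by
  simp only [gaussianPDFReal, Real.coe_toNNReal _ (sq_nonneg κ)]
  rw [mul_left_comm, ← Real.exp_add]
  congr 2
  field_simp
  ring

/-- Exponential tilting turns the noise distribution into its reflection. -/
theorem lintegral_exp_mul_noise (hκ : 0 < κ) {g : ℝ → ℝ≥0∞} (hg : Measurable g) :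
    ∫⁻ w, ENNReal.ofReal (Real.exp w) * g w ∂(noise κ) = ∫⁻ w, g (-w) ∂(noise κ) := by
  rw [noise, gaussianReal_of_var_ne_zero _ (toNNReal_sq_ne_zero hκ),
    lintegral_withDensity_eq_lintegral_mul (g := fun w => ENNReal.ofReal (Real.exp w) * g w) _
      (measurable_gaussianPDF _ _) (Real.measurable_exp.ennreal_ofReal.mul hg),
    lintegral_withDensity_eq_lintegral_mul (g := fun w => g (-w)) _
      (measurable_gaussianPDF _ _) (hg.comp measurable_neg), ← lintegral_neg_eq_self]
  refine lintegral_congr fun w => ?_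
  simp only [Pi.mul_apply, gaussianPDF]
  have h1 := exp_mul_gaussianPDFReal_noise hκ (-w)
  rw [neg_neg] at h1
  rw [← h1, ENNReal.ofReal_mul (Real.exp_pos _).le]
  ring

/-- The acceptance probability as a function of the acceptance ratio. -/
noncomputable def noisyAccept (κ : ℝ) (r : ℝ≥0) : ℝ≥0∞ :=
  ∫⁻ w, ENNReal.ofReal (min 1 ((r : ℝ) * Real.exp w)) ∂(noise κ)

theorem measurable_noisyAccept : Measurable (noisyAccept κ) := by
  have : Measurable fun z : ℝ≥0 × ℝ => ENNReal.ofReal (min 1 ((z.1 : ℝ) * Real.exp z.2)) := by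
    fun_prop
  exact this.lintegral_prod_right'

theorem noisyAccept_zero : noisyAccept κ 0 = 0 := by simp [noisyAccept]

theorem noisyAccept_lt_one (hκ : 0 < κ) (r : ℝ≥0) : noisyAccept κ r < 1 := by
  have hm : Measurable fun w => ENNReal.ofReal (min 1 ((r : ℝ) * Real.exp w)) := by fun_prop
  have hle : ∀ w, ENNReal.ofReal (min 1 ((r : ℝ) * Real.exp w)) ≤ 1 := fun w =>
    ENNReal.ofReal_le_one.mpr (min_le_left _ _)
  have h1 : noisyAccept κ r ≤ 1 := by
    calc noisyAccept κ r ≤ ∫⁻ _, 1 ∂(noise κ) := lintegral_mono hle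
      _ = 1 := by simp
  refine h1.lt_of_ne fun h2 => ?_
  have h3 : ∫⁻ w, (1 - ENNReal.ofReal (min 1 ((r : ℝ) * Real.exp w))) ∂(noise κ) = 0 := by
    rw [lintegral_sub hm (by rw [← noisyAccept, h2]; simp) (ae_of_all _ hle),
      ← noisyAccept, h2]
    simp
  rw [lintegral_eq_zero_iff (show Measurable fun w =>
    1 - ENNReal.ofReal (min 1 ((r : ℝ) * Real.exp w)) from measurable_const.sub hm)] at h3
  have h4 : ∀ᵐ w ∂(volume : Measure ℝ),
      1 - ENNReal.ofReal (min 1 ((r : ℝ) * Real.exp w)) = 0 :=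
    (gaussianReal_absolutelyContinuous' _ (toNNReal_sq_ne_zero hκ)).ae_le h3
  -- For $w<-r$ one has $re^w<e^{r+w}<1$; the threshold $-r$ also covers $r=0$, where $-\log r$
  -- would not.
  have h5 : ∀ᵐ w ∂(volume : Measure ℝ), w ∉ Set.Iio (-(r : ℝ)) := by
    filter_upwards [h4] with w hw hmem
    have h6 : (1 : ℝ) ≤ r * Real.exp w := by
      have := tsub_eq_zero_iff_le.mp hw
      rw [ENNReal.one_le_ofReal] at this
      exact this.trans (min_le_right _ _)
    have h7 : (r : ℝ) + 1 ≤ Real.exp r := Real.add_one_le_exp _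
    have h8 : Real.exp w * Real.exp r < 1 := by
      rw [← Real.exp_add, Real.exp_lt_one_iff]
      simp only [Set.mem_Iio] at hmem
      linarith
    nlinarith [Real.exp_pos w, r.coe_nonneg]
  rw [← measure_eq_zero_iff_ae_notMem] at h5
  simp at h5

/-- Detailed balance of the noisy acceptance probability. -/
theorem noisyAccept_inv (hκ : 0 < κ) {r : ℝ≥0} (hr : r ≠ 0) :
    noisyAccept κ r = r * noisyAccept κ r⁻¹ := by
  have hr0 : (0 : ℝ) < r := by positivity
  -- Factoring out $e^w$ leaves $\min\{e^{-w},r\}$, and tilting reflects this into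
  -- $\min\{e^w,r\}=r\min\{1,r^{-1}e^w\}$.
  have h1 : noisyAccept κ r =
      ∫⁻ w, ENNReal.ofReal (Real.exp w) * ENNReal.ofReal (min (Real.exp (-w)) r)
        ∂(noise κ) := by
    refine lintegral_congr fun w => ?_
    rw [← ENNReal.ofReal_mul (Real.exp_pos _).le, mul_min_of_nonneg _ _ (Real.exp_pos _).le,
      ← Real.exp_add, add_neg_cancel, Real.exp_zero, mul_comm (r : ℝ)]
  rw [h1, lintegral_exp_mul_noise hκ (g := fun w => ENNReal.ofReal (min (Real.exp (-w)) r))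
    (by fun_prop), noisyAccept, ← lintegral_const_mul _ (by fun_prop)]
  refine lintegral_congr fun w => ?_
  rw [neg_neg, ← ENNReal.ofReal_coe_nnreal (p := r), ← ENNReal.ofReal_mul hr0.le,
    mul_min_of_nonneg _ _ hr0.le, NNReal.coe_inv, mul_inv_cancel_left₀ hr0.ne', mul_one, min_comm]

/-- Holds pointwise in $w$: $\min\{1,e^w\}\min\{1,r\}$ is at most $1$ and at most $re^w$. -/
theorem mul_noisyAccept_one_le (r : ℝ≥0) :
    noisyAccept κ 1 * ((min 1 r : ℝ≥0) : ℝ≥0∞) ≤ noisyAccept κ r := by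
  rw [noisyAccept, noisyAccept, ← lintegral_mul_const _ (by fun_prop)]
  refine lintegral_mono fun w => ?_
  rw [← ENNReal.ofReal_coe_nnreal, ← ENNReal.ofReal_mul (by positivity)]
  refine ENNReal.ofReal_le_ofReal ?_
  have he := Real.exp_pos w
  have hr := r.coe_nonneg
  push_cast
  rw [one_mul]
  refine le_min ?_ ?_
  · exact mul_le_one₀ (min_le_left _ _) (by positivity) (min_le_left _ _)
  · rw [mul_comm (r : ℝ)]
    gcongr
    · exact min_le_right _ _
    · exact min_le_right _ _

theorem rhoU_eq_toReal : rhoU κ = (noisyAccept κ 1).toReal := by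
  rw [rhoU, noisyAccept, integral_eq_lintegral_of_nonneg_ae
    (ae_of_all _ fun w => by positivity) (by fun_prop)]
  simp

theorem ofReal_rhoU (hκ : 0 < κ) : ENNReal.ofReal (rhoU κ) = noisyAccept κ 1 := by
  rw [rhoU_eq_toReal, ENNReal.ofReal_toReal ((noisyAccept_lt_one hκ 1).trans_le le_top).ne]

theorem rhoU_lt_one (hκ : 0 < κ) : rhoU κ < 1 := by
  have := noisyAccept_lt_one hκ 1
  rw [← ofReal_rhoU hκ, ENNReal.ofReal_lt_one] at this
  exact this

theorem rhoU_pos : 0 < rhoU κ := by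
  rw [rhoU_eq_toReal, ENNReal.toReal_pos_iff]
  constructor
  · refine pos_iff_ne_zero.mpr fun h => ?_
    rw [noisyAccept, lintegral_eq_zero_iff (by fun_prop)] at h
    obtain ⟨w, hw⟩ := h.exists
    simp only [Pi.zero_apply, ENNReal.ofReal_eq_zero, NNReal.coe_one, one_mul] at hw
    exact absurd hw (not_le.mpr (lt_min one_pos (Real.exp_pos w)))
  · refine lt_of_le_of_lt (lintegral_mono (g := fun _ => 1) fun w =>
      ENNReal.ofReal_le_one.mpr (min_le_left _ _)) (by simp)

theorem noise_Ici_zero (hκ : 0 < κ) :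
    noise κ (Set.Ici 0) = gaussianReal 0 1 (Set.Iic (-κ / 2)) := by
  -- The negative slope $-\kappa$ turns the upper half-line directly into the lower tail at
  -- $-\kappa/2$.
  have h1 : (gaussianReal 0 1).map (fun x => -κ * x + -(κ ^ 2) / 2) = noise κ := by
    have h2 : (fun x => -κ * x + -(κ ^ 2) / 2) = (fun x => x + -(κ ^ 2) / 2) ∘ (fun x => -κ * x) :=
      rfl
    rw [h2, ← Measure.map_map (by fun_prop) (by fun_prop), gaussianReal_map_const_mul,
      gaussianReal_map_add_const, noise]
    congr 1
    · simp
    · ext; simp [sq_nonneg]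
  rw [← h1, Measure.map_apply (by fun_prop) measurableSet_Ici]
  congr 1
  ext x
  simp only [Set.mem_preimage, Set.mem_Ici, Set.mem_Iic]
  constructor
  · intro h
    nlinarith
  · intro h
    nlinarith

/-- The region $w\ge0$ contributes its mass; tilting turns the contribution $e^w$ of $w<0$ into the
mass of $w>0$. The two agree as there is no atom at $0$, hence the factor $2$. -/
theorem rhoU_eq_cdf (hκ : 0 < κ) : rhoU κ = 2 * cdf (gaussianReal 0 1) (-κ / 2) := by
  have hatom : noise κ {0} = 0 := gaussianReal_absolutelyContinuous _ (toNNReal_sq_ne_zero hκ)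
    (Real.volume_singleton)
  have hIoi : noise κ (Set.Ioi 0) = noise κ (Set.Ici 0) := by
    refine measure_congr ?_
    rw [← Set.Ioi_union_left]
    exact (union_ae_eq_left_of_ae_eq_empty (ae_eq_empty.mpr hatom)).symm
  have h1 : noisyAccept κ 1 = ∫⁻ w in Set.Ici 0, 1 ∂(noise κ) +
      ∫⁻ w, ENNReal.ofReal (Real.exp w) * (Set.Iio 0).indicator 1 w ∂(noise κ) := by
    rw [← lintegral_indicator measurableSet_Ici,
      ← lintegral_add_left (measurable_const.indicator measurableSet_Ici)]
    refine lintegral_congr fun w => ?_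
    rcases le_or_gt 0 w with hw | hw
    · simp [hw, Real.one_le_exp hw, hw.not_gt]
    · simp [hw, hw.le, hw.not_ge]
  have h2 : noisyAccept κ 1 = 2 * gaussianReal 0 1 (Set.Iic (-κ / 2)) := by
    rw [h1, lintegral_exp_mul_noise hκ (measurable_one.indicator measurableSet_Iio)]
    have h3 : ∫⁻ w, (Set.Iio 0).indicator (1 : ℝ → ℝ≥0∞) (-w) ∂(noise κ) =
        noise κ (Set.Ioi 0) := by
      rw [← lintegral_indicator_one measurableSet_Ioi]
      refine lintegral_congr fun w => ?_
      by_cases hw : 0 < w <;> simp [hw]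
    rw [h3, hIoi, noise_Ici_zero hκ, setLIntegral_one, noise_Ici_zero hκ, two_mul]
  rw [rhoU_eq_toReal, h2, cdf_eq_real, ENNReal.toReal_mul]
  rfl

end Noise

/-! ### Geometric ergodicity of the lazy chain -/

section GeometricErgodicity

variable {E : Type*} [MeasurableSpace E] {a : ℝ} {K : Kernel E E}

theorem lintegral_lazyKernel (x : E) {g : E → ℝ≥0∞} (hg : Measurable g) :
    ∫⁻ y, g y ∂(lazyKernel a K x) =
      ENNReal.ofReal a * ∫⁻ y, g y ∂(K x) + ENNReal.ofReal (1 - a) * g x := by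
  change ∫⁻ y, g y ∂(ENNReal.ofReal a • K x + ENNReal.ofReal (1 - a) • Measure.dirac x) = _
  rw [lintegral_add_measure, lintegral_smul_measure, lintegral_smul_measure,
    lintegral_dirac' _ hg]
  rfl

theorem mul_lazyKernel_apply (X : Kernel E E) (x : E) {s : Set E} (hs : MeasurableSet s) :
    (X * lazyKernel a K) x s =
      ENNReal.ofReal a * (X * K) x s + ENNReal.ofReal (1 - a) * X x s := by
  change (X ∘ₖ lazyKernel a K) x s = ENNReal.ofReal a * (X ∘ₖ K) x s + _
  rw [Kernel.comp_apply' _ _ _ hs, Kernel.comp_apply' _ _ _ hs,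
    lintegral_lazyKernel x (X.measurable_coe hs)]

theorem commute_lazyKernel : Commute K (lazyKernel a K) := by
  ext x s hs
  rw [mul_lazyKernel_apply K x hs]
  change _ = (lazyKernel a K ∘ₖ K) x s
  rw [Kernel.comp_apply' _ _ _ hs]
  change _ = ∫⁻ y, (ENNReal.ofReal a • K y + ENNReal.ofReal (1 - a) • Measure.dirac y) s ∂(K x)
  simp only [Measure.add_apply, Measure.smul_apply, smul_eq_mul, Measure.dirac_apply' _ hs]
  rw [lintegral_add_left ((K.measurable_coe hs).const_mul _),
    lintegral_const_mul _ (K.measurable_coe hs),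
    lintegral_const_mul _ (measurable_one.indicator hs), lintegral_indicator_one hs]
  change _ * (K ∘ₖ K) x s + _ = _
  rw [Kernel.comp_apply' _ _ _ hs]

theorem isMarkovKernel_pow (X : Kernel E E) [IsMarkovKernel X] (n : ℕ) :
    IsMarkovKernel (X ^ n) := by
  induction n with
  | zero => rw [pow_zero]; exact inferInstanceAs (IsMarkovKernel Kernel.id)
  | succ n ih => rw [pow_succ]; exact inferInstanceAs (IsMarkovKernel ((X ^ n) ∘ₖ X))

/-- Keeping $K^m$ in front makes the induction close: a lazy step adds one factor $K$ with weight
$a$ and none with weight $1-a$, so it multiplies the bound by $a\rho+(1-a)$. -/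
theorem abs_pow_mul_lazyKernel_pow_sub_le (ha0 : 0 ≤ a) (ha1 : a ≤ 1) [IsMarkovKernel K]
    [IsMarkovKernel (lazyKernel a K)] {x : E} {s : Set E} (hs : MeasurableSet s) {c M ρ : ℝ}
    (hb : ∀ m : ℕ, |((K ^ m) x).real s - c| ≤ M * ρ ^ m) (n m : ℕ) :
    |((K ^ m * lazyKernel a K ^ n) x).real s - c| ≤ M * ρ ^ m * (a * ρ + (1 - a)) ^ n := by
  induction n generalizing m with
  | zero => simpa using hb m
  | succ n ih =>
    have hmk : ∀ m n : ℕ, IsMarkovKernel (K ^ m * lazyKernel a K ^ n) := fun m n => by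
      have := isMarkovKernel_pow K m
      have := isMarkovKernel_pow (lazyKernel a K) n
      exact inferInstanceAs (IsMarkovKernel ((K ^ m) ∘ₖ (lazyKernel a K ^ n)))
    have h1 : K ^ m * lazyKernel a K ^ n * K = K ^ (m + 1) * lazyKernel a K ^ n := by
      rw [mul_assoc, ((commute_lazyKernel (K := K) (a := a)).pow_right n).eq.symm, ← mul_assoc,
        pow_succ]
    have h2 : ((K ^ m * lazyKernel a K ^ (n + 1)) x).real s =
        a * ((K ^ (m + 1) * lazyKernel a K ^ n) x).real s +
          (1 - a) * ((K ^ m * lazyKernel a K ^ n) x).real s := by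
      have := hmk m n
      have := hmk (m + 1) n
      rw [pow_succ (lazyKernel a K), ← mul_assoc, measureReal_def, mul_lazyKernel_apply _ _ hs, h1,
        ENNReal.toReal_add (ENNReal.mul_ne_top ENNReal.ofReal_ne_top (measure_ne_top _ _))
          (ENNReal.mul_ne_top ENNReal.ofReal_ne_top (measure_ne_top _ _)),
        ENNReal.toReal_mul, ENNReal.toReal_mul, ENNReal.toReal_ofReal ha0,
        ENNReal.toReal_ofReal (by linarith)]
      rfl
    have h3 := ih (m + 1)
    have h4 := ih m
    rw [h2]
    set u := ((K ^ (m + 1) * lazyKernel a K ^ n) x).real s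
    set v := ((K ^ m * lazyKernel a K ^ n) x).real s
    calc |a * u + (1 - a) * v - c| = |a * (u - c) + (1 - a) * (v - c)| := by congr 1; ring
      _ ≤ |a * (u - c)| + |(1 - a) * (v - c)| := abs_add_le _ _
      _ = a * |u - c| + (1 - a) * |v - c| := by
        rw [abs_mul, abs_mul, abs_of_nonneg ha0, abs_of_nonneg (sub_nonneg.mpr ha1)]
      _ ≤ a * (M * ρ ^ (m + 1) * (a * ρ + (1 - a)) ^ n) +
          (1 - a) * (M * ρ ^ m * (a * ρ + (1 - a)) ^ n) :=
        add_le_add (mul_le_mul_of_nonneg_left h3 ha0)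
          (mul_le_mul_of_nonneg_left h4 (sub_nonneg.mpr ha1))
      _ = _ := by ring

theorem GeometricallyErgodic.lazyKernel {μ : Measure E} (ha0 : 0 < a) (ha1 : a ≤ 1)
    [IsMarkovKernel K] [IsMarkovKernel (BoundingChain.lazyKernel a K)] (hK : GeometricallyErgodic K μ) :
    GeometricallyErgodic (BoundingChain.lazyKernel a K) μ := by
  obtain ⟨ρ, hρ0, hρ1, M, hM⟩ := hK
  refine ⟨a * ρ + (1 - a), add_nonneg (by positivity) (by linarith), by nlinarith, M, ?_⟩
  filter_upwards [hM] with x hx n s hs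
  simpa using abs_pow_mul_lazyKernel_pow_sub_le ha0.le ha1 hs (fun m => hx m s hs) n 0

end GeometricErgodicity

/-! ### The three acceptance rules and the case of equality -/

section Acceptance

variable {Θ : Type*} {p : Θ → ℝ≥0}
  {q : Θ → Θ → ℝ≥0} {κ : ℝ}

theorem alphaHat_eq (x y : Θ) : alphaHat κ p q x y = noisyAccept κ (rEX p q x y) := rfl

/-- Acceptance rules that satisfy `F r = r F(r⁻¹)` lead to detailed balance. -/
theorem detailed_balance {F : ℝ≥0 → ℝ≥0∞} (hF0 : F 0 = 0) (hF : ∀ r ≠ 0, F r = r * F r⁻¹)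
    (x y : Θ) : (p x : ℝ≥0∞) * (q x y * F (rEX p q x y)) = p y * (q y x * F (rEX p q y x)) := by
  rw [← mul_assoc, ← mul_assoc, ← ENNReal.coe_mul, ← ENNReal.coe_mul, rEX, rEX]
  generalize p x * q x y = a
  generalize p y * q y x = b
  -- If exactly one flow vanishes, the convention $r=1$ is harmless on its side, and the reverse
  -- ratio is $0$, so `hF0` applies.
  by_cases ha : a = 0 <;> by_cases hb : b = 0
  · simp [ha, hb]
  · simp [ha, hb, hF0]
  · simp [ha, hb, hF0]
  · rw [if_neg ha, if_neg hb, hF (b / a) (div_ne_zero hb ha), ← mul_assoc, ← ENNReal.coe_mul,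
      mul_div_cancel₀ b ha, inv_div]

theorem alphaEX_symm (x y : Θ) :
    (p x : ℝ≥0∞) * (q x y * alphaEX p q x y) = p y * (q y x * alphaEX p q y x) := by
  refine detailed_balance (F := fun r => ((min 1 r : ℝ≥0) : ℝ≥0∞)) (by simp) (fun r hr => ?_) x y
  rw [← ENNReal.coe_mul, mul_min, mul_one, mul_inv_cancel₀ hr, min_comm]

theorem alphaHat_symm (hκ : 0 < κ) (x y : Θ) :
    (p x : ℝ≥0∞) * (q x y * alphaHat κ p q x y) = p y * (q y x * alphaHat κ p q y x) :=
  detailed_balance noisyAccept_zero (fun _ hr => noisyAccept_inv hκ hr) x y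

theorem alphaStar_symm (x y : Θ) :
    (p x : ℝ≥0∞) * (q x y * alphaStar κ p q x y) = p y * (q y x * alphaStar κ p q y x) := by
  have := alphaEX_symm (p := p) (q := q) x y
  simp only [alphaStar]
  rw [mul_left_comm (q x y : ℝ≥0∞), mul_left_comm, this]
  ring

theorem alphaEX_le_one (x y : Θ) : alphaEX p q x y ≤ 1 := by
  simp [alphaEX]

theorem alphaHat_lt_one (hκ : 0 < κ) (x y : Θ) : alphaHat κ p q x y < 1 :=
  noisyAccept_lt_one hκ _

theorem alphaStar_lt_one (hκ : 0 < κ) (x y : Θ) : alphaStar κ p q x y < 1 := by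
  refine (mul_le_of_le_one_right' (alphaEX_le_one x y)).trans_lt ?_
  rw [ofReal_rhoU hκ]
  exact noisyAccept_lt_one hκ 1

theorem alphaStar_le_alphaHat (hκ : 0 < κ) (x y : Θ) :
    alphaStar κ p q x y ≤ alphaHat κ p q x y := by
  rw [alphaStar, ofReal_rhoU hκ]
  exact mul_noisyAccept_one_le _

variable [MeasurableSpace Θ]

theorem measurable_rEX (hp : Measurable p) (hq : Measurable (Function.uncurry q)) :
    Measurable (Function.uncurry (rEX p q)) := by
  have h1 : Measurable fun z : Θ × Θ => p z.1 * q z.1 z.2 :=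
    (hp.comp measurable_fst).mul hq
  have h2 : Measurable fun z : Θ × Θ => p z.2 * q z.2 z.1 := h1.comp measurable_swap
  exact Measurable.ite (h1 (measurableSet_singleton 0)) measurable_const (h2.div h1)

theorem measurable_alphaEX (hp : Measurable p) (hq : Measurable (Function.uncurry q)) :
    Measurable (Function.uncurry (alphaEX p q)) :=
  ((measurable_const.min (measurable_rEX hp hq)) : Measurable fun z : Θ × Θ =>
    min 1 (rEX p q z.1 z.2)).coe_nnreal_ennreal

theorem measurable_alphaHat (hp : Measurable p) (hq : Measurable (Function.uncurry q)) :
    Measurable (Function.uncurry (alphaHat κ p q)) :=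
  measurable_noisyAccept.comp (measurable_rEX hp hq)

theorem measurable_alphaStar (hp : Measurable p) (hq : Measurable (Function.uncurry q)) :
    Measurable (Function.uncurry (alphaStar κ p q)) :=
  (measurable_alphaEX hp hq).const_mul _

variable {ν : Measure Θ} [SigmaFinite ν]

/-- If no exact proposal is ever rejected, the acceptance ratio is identically `1` at
stationarity, and the noisy and the bounding kernels agree. -/
theorem ae_mhKernel_alphaHat_eq (hκ : 0 < κ) (hp : Measurable p)
    (hq : Measurable (Function.uncurry q))
    (hq1 : ∀ θ, ∫⁻ θ', (q θ θ' : ℝ≥0∞) ∂ν = 1)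
    (hacc : ∀ᵐ θ ∂(target ν p), accProb ν q (alphaEX p q) θ = 1) :
    ∀ᵐ θ ∂(target ν p),
      mhKernel ν q (alphaHat κ p q) θ = mhKernel ν q (alphaStar κ p q) θ := by
  have hpm := hp.coe_nnreal_ennreal
  have ha : Measurable fun z : Θ × Θ => p z.1 * q z.1 z.2 := (hp.comp measurable_fst).mul hq
  have hb : Measurable fun z : Θ × Θ => p z.2 * q z.2 z.1 := ha.comp measurable_swap
  -- Sure acceptance forces $\min\{1,r\}=1$ wherever $\pi(x)q(x,y)>0$.
  have hle : ∀ᵐ z ∂(ν.prod ν), p z.1 * q z.1 z.2 ≤ p z.2 * q z.2 z.1 := by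
    rw [Measure.ae_prod_iff_ae_ae (measurableSet_le ha hb)]
    rw [target, ae_withDensity_iff hpm] at hacc
    filter_upwards [hacc] with x hx
    by_cases hpx : p x = 0
    · simp [hpx]
    have hx := hx (by simpa using hpx)
    have hqx : Measurable fun y => (q x y : ℝ≥0∞) :=
      (hq.comp measurable_prodMk_left).coe_nnreal_ennreal
    have h1 : (fun y => (q x y : ℝ≥0∞) * alphaEX p q x y) =ᵐ[ν] fun y => (q x y : ℝ≥0∞) := by
      refine ae_eq_of_ae_le_of_lintegral_le
        (ae_of_all _ fun y => mul_le_of_le_one_right' (alphaEX_le_one x y)) ?_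
        hqx.aemeasurable ?_
      · exact hx.trans_ne ENNReal.one_ne_top
      · rw [hq1]; exact hx.ge
    filter_upwards [h1] with y hy
    by_cases hqy : q x y = 0
    · simp [hqy]
    have ha0 : p x * q x y ≠ 0 := mul_ne_zero hpx hqy
    rw [alphaEX, ← ENNReal.coe_mul, ENNReal.coe_inj, mul_eq_left₀ hqy, min_eq_left_iff, rEX,
      if_neg ha0, one_le_div (pos_iff_ne_zero.mpr ha0)] at hy
    exact hy
  -- Swapping the coordinates reverses the inequality while preserving $\nu\otimes\nu$.
  have heq : ∀ᵐ z ∂(ν.prod ν), p z.1 * q z.1 z.2 = p z.2 * q z.2 z.1 := by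
    have hswap : MeasurePreserving Prod.swap (ν.prod ν) (ν.prod ν) :=
      Measure.measurePreserving_swap
    filter_upwards [hle, hswap.quasiMeasurePreserving.ae hle] with z h1 h2
    exact le_antisymm h1 h2
  rw [Measure.ae_prod_iff_ae_ae (measurableSet_eq_fun ha hb)] at heq
  rw [target, ae_withDensity_iff hpm]
  filter_upwards [heq] with x hx hpx
  have hpx : p x ≠ 0 := by simpa using hpx
  have h1 : (fun y => (q x y : ℝ≥0∞) * alphaHat κ p q x y) =ᵐ[ν]
      fun y => (q x y : ℝ≥0∞) * alphaStar κ p q x y := by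
    filter_upwards [hx] with y hy
    by_cases hqy : q x y = 0
    · simp [hqy]
    have ha0 : p x * q x y ≠ 0 := mul_ne_zero hpx hqy
    have hr : rEX p q x y = 1 := by
      rw [rEX, if_neg ha0, ← hy, div_self ha0]
    rw [alphaHat_eq, alphaStar, alphaEX, hr, ofReal_rhoU hκ]
    simp
  rw [mhKernel_apply ν hq (measurable_alphaHat hp hq),
    mhKernel_apply ν hq (measurable_alphaStar hp hq), withDensity_congr_ae h1, accProb, accProb,
    lintegral_congr_ae h1]

end Acceptance

theorem kerOp_congr {E : Type*} [MeasurableSpace E] {μ : Measure E} [IsFiniteMeasure μ]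
    {K K' : Kernel E E} [IsMarkovKernel K] [IsMarkovKernel K'] (hK : K.Invariant μ)
    (hK' : K'.Invariant μ) (h : ∀ᵐ x ∂μ, K x = K' x) : kerOp hK = kerOp hK' := by
  ext1 f
  ext1
  filter_upwards [kerOp_coe hK f, kerOp_coe hK' f, h] with x h1 h2 h3
  rw [h1, h2, h3]

end BoundingChain

/-! ### Assembly of the proposition -/

open BoundingChain in
theorem proposition1 {Θ : Type*} [MeasurableSpace Θ] (ν : Measure Θ) [SigmaFinite ν]
    (p : Θ → ℝ≥0) (hp : Measurable p) (hp1 : ∫⁻ θ, (p θ : ℝ≥0∞) ∂ν = 1)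
    (q : Θ → Θ → ℝ≥0) (hq : Measurable (Function.uncurry q))
    (hq1 : ∀ θ, ∫⁻ θ', (q θ θ' : ℝ≥0∞) ∂ν = 1)
    (κ : ℝ) (hκ : 0 < κ) :
    -- the value of `ϱ_U(κ)`
    rhoU κ = 2 * cdf (gaussianReal 0 1) (-κ / 2) ∧
    -- reversibility
    Kernel.IsReversible (QStar ν κ p q) (target ν p) ∧
    -- inefficiencies, for every non-constant `h` in `L²(π)`
    (∀ h : Θ → ℝ, MemLp h 2 (target ν p) → 0 < ∫ θ, centred (target ν p) h θ ^ 2 ∂(target ν p) →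
      (∃ vHat vStar : EReal,
        HasIF (target ν p) (QHat ν κ p q) h vHat ∧
        HasIF (target ν p) (QStar ν κ p q) h vStar ∧
        vHat ≤ vStar ∧
        (∀ v : EReal, HasIF (target ν p) (QEX ν p q) h v →
          vStar = (1 + v) / ((rhoU κ : ℝ) : EReal) - 1) ∧
        ((∀ᵐ θ ∂(target ν p), accProb ν q (alphaEX p q) θ = 1) → vHat = vStar)) ∧
      -- `IF(h, Q_EX)` is well defined unless `-1` is an eigenvalue of `Q_EX` on `L²(π)`
      ((∀ g : Θ → ℝ, MemLp g 2 (target ν p) →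
          (∀ᵐ θ ∂(target ν p), ∫ θ', g θ' ∂(QEX ν p q θ) = -g θ) →
          ∀ᵐ θ ∂(target ν p), g θ = 0) →
        ∃ v : EReal, HasIF (target ν p) (QEX ν p q) h v)) ∧
    -- average acceptance probabilities
    QStar ν κ p q = mhKernel ν q (alphaStar κ p q) ∧
    avgAccProb ν p q (alphaStar κ p q) =
      ENNReal.ofReal (rhoU κ) * ∫⁻ θ, accProb ν q (alphaEX p q) θ ∂(target ν p) ∧
    avgAccProb ν p q (alphaStar κ p q) ≤ avgAccProb ν p q (alphaHat κ p q) ∧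
    -- geometric ergodicity
    (GeometricallyErgodic (QEX ν p q) (target ν p) →
      GeometricallyErgodic (QStar ν κ p q) (target ν p)) := by
  have hπ : IsProbabilityMeasure (target ν p) := isProbabilityMeasure_target hp1
  have hρ0 : 0 < rhoU κ := rhoU_pos
  have hρ1 : rhoU κ < 1 := rhoU_lt_one hκ
  have mEX := measurable_alphaEX hp hq
  have mHat := measurable_alphaHat (κ := κ) hp hq
  have mStar := measurable_alphaStar (κ := κ) hp hq
  have hstar : QStar ν κ p q = mhKernel ν q (alphaStar κ p q) :=
    lazyKernel_mhKernel hρ0.le hρ1.le hq hq1 mEX alphaEX_le_one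
  have kEX : IsMarkovKernel (QEX ν p q) := isMarkovKernel_mhKernel hq hq1 mEX alphaEX_le_one
  have kHat : IsMarkovKernel (mhKernel ν q (alphaHat κ p q)) :=
    isMarkovKernel_mhKernel hq hq1 mHat fun x y => (alphaHat_lt_one hκ x y).le
  have kStar : IsMarkovKernel (mhKernel ν q (alphaStar κ p q)) :=
    isMarkovKernel_mhKernel hq hq1 mStar fun x y => (alphaStar_lt_one hκ x y).le
  have revEX : (QEX ν p q).IsReversible (target ν p) :=
    isReversible_mhKernel hp hq mEX alphaEX_symm
  have revHat : (mhKernel ν q (alphaHat κ p q)).IsReversible (target ν p) :=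
    isReversible_mhKernel hp hq mHat (alphaHat_symm hκ)
  have revStar : (mhKernel ν q (alphaStar κ p q)).IsReversible (target ν p) :=
    isReversible_mhKernel hp hq mStar alphaStar_symm
  have kLazy : IsMarkovKernel (lazyKernel (rhoU κ) (QEX ν p q)) :=
    (hstar ▸ kStar : IsMarkovKernel (QStar ν κ p q))
  have iLazy : (lazyKernel (rhoU κ) (QEX ν p q)).Invariant (target ν p) :=
    (hstar ▸ revStar.invariant : (QStar ν κ p q).Invariant (target ν p))
  -- The lazy form of $Q^*$ gives the inefficiency formula, the Metropolis–Hastings form gives the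
  -- ordering; their operators must be identified.
  have hlazy : kerOp iLazy = kerOp revStar.invariant :=
    kerOp_congr _ _ (ae_of_all _ fun x => congrArg (fun K => K x) hstar)
  refine ⟨rhoU_eq_cdf hκ, hstar ▸ revStar, fun h hh hpos => ⟨?_, fun hne => ?_⟩, hstar, ?_, ?_,
    fun hge => hge.lazyKernel hρ0 hρ1.le⟩
  · have hunit := norm_unitCentred hh hpos
    have sHat := isSymmetric_kerOp revHat.invariant revHat
    have sStar := isSymmetric_kerOp revStar.invariant revStar
    obtain ⟨vHat, hvHat⟩ := exists_tendsto_opIF sHat (norm_kerOp_le _)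
      (eq_zero_of_kerOp_mhKernel_eq_neg hq hq1 mHat (alphaHat_lt_one hκ) revHat.invariant) hunit
    obtain ⟨vStar, hvStar⟩ := exists_tendsto_opIF sStar (norm_kerOp_le _)
      (eq_zero_of_kerOp_mhKernel_eq_neg hq hq1 mStar (alphaStar_lt_one hκ) revStar.invariant) hunit
    refine ⟨vHat, vStar, (hasIF_iff revHat.invariant hh).mpr hvHat, ?_, ?_, fun v hv => ?_,
      fun hacc => ?_⟩
    · rw [hstar]
      exact (hasIF_iff revStar.invariant hh).mpr hvStar
    · exact opIF_limit_le sHat sStar (norm_kerOp_le _) (norm_kerOp_le _)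
        (inner_kerOp_mhKernel_le hq mHat mStar _ _ (alphaStar_le_alphaHat hκ)) hunit hvHat hvStar
    · refine opIF_limit_lazy (isSymmetric_kerOp revEX.invariant revEX) sStar (norm_kerOp_le _)
        (norm_kerOp_le _) hρ0 (fun f => ?_) hunit ((hasIF_iff revEX.invariant hh).mp hv) hvStar
      rw [← hlazy]
      exact kerOp_lazyKernel hρ0.le hρ1.le revEX.invariant iLazy f
    · rw [kerOp_congr revHat.invariant revStar.invariant
        (ae_mhKernel_alphaHat_eq hκ hp hq hq1 hacc)] at hvHat
      exact tendsto_nhds_unique hvHat hvStar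
  · have hne' : ∀ f, kerOp revEX.invariant f = -f → f = 0 := by
      intro f hf
      rw [Lp.eq_zero_iff_ae_eq_zero]
      refine hne f (Lp.memLp f) ?_
      have h1 := kerOp_coe revEX.invariant f
      rw [hf] at h1
      filter_upwards [h1, Lp.coeFn_neg f] with x hx hx'
      rw [← hx, hx', Pi.neg_apply]
    obtain ⟨v, hv⟩ := exists_tendsto_opIF (isSymmetric_kerOp revEX.invariant revEX)
      (norm_kerOp_le _) hne' (norm_unitCentred hh hpos)
    exact ⟨v, (hasIF_iff revEX.invariant hh).mpr hv⟩
  · rw [avgAccProb, ← lintegral_const_mul _ (measurable_accProb hq mEX)]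
    refine lintegral_congr fun x => ?_
    rw [accProb, accProb, ← lintegral_const_mul _ (measurable_mul_accept_right hq mEX x)]
    refine lintegral_congr fun y => ?_
    rw [alphaStar, mul_left_comm]
  · refine lintegral_mono fun x => lintegral_mono fun y => ?_
    dsimp only
    gcongr
    exact alphaStar_le_alphaHat hκ x y
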